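/- Let $E$ be a finite-dimensional real normed space (for instance $\mathbb{R}^n$ with any norm), let $\mathcal{L}(E)$ carry the operator norm, and let $A:[0,\infty)\to\mathcal{L}(E)$ be of bounded variation on every compact subinterval, left-continuous on $(0,\infty)$, and satisfy (D) $I-\Delta^-A(t)$ is invertible for all $t>0$ and $I+\Delta^+A(t)$ is invertible for all $t\ge 0$, where $\Delta^-A(t)=A(t)-A(t^-)$ and $\Delta^+A(t)=A(t^+)-A(t)$. Integrals $\int_a^b \mathrm{d}[A(s)]x(s)$ are Kurzweil–Stieltjes integrals, i.e. the limits, over gauge-fine tagged partitions $(\alpha_j,\tau_j)$ of $[a,b]$, of the sums $\sum_j [A(\alpha_j)-A(\alpha_{j-1})]x(\tau_j)$, with $\int_b^a=-\int_a^b$. A function $x$ is a solution of $\frac{dx}{d\tau}=D[A(t)x]$ on $[s_0,\infty)$ if $x(d)-x(c)=\int_c^d \mathrm{d}[A(s)]x(s)$ (the integral existing) for all $s_0\le c\le d$. The trivial solution $x\equiv0$ of this equation is called * *uniformly stable* if for every $\varepsilon>0$ there is $\delta>0$ such that for all $s_0\ge0$ every solution $x$ on $[s_0,\infty)$ with $\|x(s_0)\|<\delta$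 satisfies $\|x(t)\|<\varepsilon$ for all $t\ge s_0$; *uniformly asymptotically stable* if moreover there is $\delta_0>0$ such that for every $\varepsilon>0$ there is $T\ge0$ such that for all $s_0\ge 0$ every solution $x$ on $[s_0,\infty)$ with $\|x(s_0)\|<\delta_0$ satisfies $\|x(t)\|<\varepsilon$ for all $t\ge s_0+T$; * *globally uniformly exponentially stable* if there are $K,\alpha>0$ such that for all $s_0\ge0$ every solution $x$ on $[s_0,\infty)$ satisfies $\|x(t)\|\le K\|x(s_0)\|e^{-\alpha(t-s_0)}$ for all $t\ge s_0$. For $s_0\ge 0$ let $\mathcal{Y}_{s_0}$ be the set of functions $y:[s_0,\infty)\to E$ that are locally of bounded variation on $[s_0,\infty)$ and left-continuous on $(s_0,\infty)$, and for $y\in\mathcal{Y}_{s_0}$ put $$V_{s_0}(y)=\sup_{t\ge s_0}\operatorname{var}_{s_0}^{t}\Big(s\mapsto y(s)-\int_{s_0}^{s}\mathrm{d}[A(\xi)]y(\xi)\Big)\in[0,\infty].$$ The trivial solution is called * *variationally stable* if for every $\varepsilon>0$ there is $\delta>0$ such that for all $s_0\ge0$ and $y\in\mathcal{Y}_{s_0}$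 with $\|y(s_0)\|<\delta$ and $V_{s_0}(y)<\delta$ one has $\|y(t)\|<\varepsilon$ for all $t\ge s_0$; * *variationally attracting* if there is $\delta_0>0$ such that for every $\varepsilon>0$ there are $T\ge0$ and $\gamma>0$ such that for all $s_0\ge0$ and $y\in\mathcal{Y}_{s_0}$ with $\|y(s_0)\|<\delta_0$ and $V_{s_0}(y)<\gamma$ one has $\|y(t)\|<\varepsilon$ for all $t\ge s_0+T$; * *variationally asymptotically stable* if it is variationally stable and variationally attracting. **Theorem.** There is a unique function $U:[0,\infty)\times[0,\infty)\to\mathcal{L}(E)$ with $U(t,s)=I+\int_s^t \mathrm{d}[A(r)]U(r,s)$ for all $t,s\ge0$ (the transition matrix), and the trivial solution is variationally asymptotically stable if and only if there are constants $K,\alpha>0$ such that $$\|U(t,s)\|\le K e^{-\alpha(t-s)}\qquad\text{for all } t\ge s\ge0 .$$ Moreover, the trivial solution is variationally asymptotically stable if and only if it is uniformly asymptotically stable, and if and only if it is globally uniformly exponentially stable. -/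

import Mathlib

open Set Filter Topology

namespace GLDE

section Kurzweil

variable {X : Type*} [NormedAddCommGroup X]

/-- A tagged partition `a = pt 0 < pt 1 < ⋯ < pt size = b` of `[a, b]`, with a tag
`tag j ∈ [pt j, pt (j + 1)]` for each `j < size`. The values of `pt` beyond `size`, and of `tag`
from `size` on, play no role. If `a = b` then `size = 0`; if `b < a` there is none. -/
structure TaggedPartition (a b : ℝ) where
  /-- the number of subintervals -/
  size : ℕ
  /-- the division points -/
  pt : ℕ → ℝ
  /-- the tags -/
  tag : ℕ → ℝ
  pt_zero : pt 0 = a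
  pt_size : pt size = b
  pt_lt : ∀ j < size, pt j < pt (j + 1)
  tag_mem : ∀ j < size, tag j ∈ Icc (pt j) (pt (j + 1))

/-- A tagged partition is `δ`-fine if each subinterval lies in
`(tag - δ (tag), tag + δ (tag))`. -/
def TaggedPartition.IsFine {a b : ℝ} (P : TaggedPartition a b) (δ : ℝ → ℝ) : Prop :=
  ∀ j < P.size, Icc (P.pt j) (P.pt (j + 1)) ⊆
    Ioo (P.tag j - δ (P.tag j)) (P.tag j + δ (P.tag j))

/-- The sum `∑ⱼ [G(τⱼ, αⱼ) - G(τⱼ, αⱼ₋₁)]` over a tagged partition. -/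
def TaggedPartition.sum {a b : ℝ} (P : TaggedPartition a b) (G : ℝ → ℝ → X) : X :=
  ∑ j ∈ Finset.range P.size, (G (P.tag j) (P.pt (j + 1)) - G (P.tag j) (P.pt j))

/-- For `a ≤ b`: `I` is the Kurzweil integral `∫_a^b D G(τ, t)`. -/
def HasKurzweilIntegral (G : ℝ → ℝ → X) (a b : ℝ) (I : X) : Prop :=
  ∀ ε > 0, ∃ δ : ℝ → ℝ, (∀ t ∈ Icc a b, 0 < δ t) ∧
    ∀ P : TaggedPartition a b, P.IsFine δ → ‖P.sum G - I‖ < ε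

/-- For `a ≤ b`: Kurzweil integrability of `G` on `[a, b]`. -/
def KurzweilIntegrable (G : ℝ → ℝ → X) (a b : ℝ) : Prop :=
  ∃ I : X, HasKurzweilIntegral G a b I

open Classical in
/-- The Kurzweil integral `∫_a^b D G(τ, t)`, with `∫_a^b = - ∫_b^a` if `b < a`
(and the value `0` if `G` is not integrable). -/
noncomputable def kurzweilIntegral (G : ℝ → ℝ → X) (a b : ℝ) : X :=
  if a ≤ b then
    if h : KurzweilIntegrable G a b then h.choose else 0
  else
    if h : KurzweilIntegrable G b a then -h.choose else 0

/-- Adding one more subinterval on the right of a tagged partition. -/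
def TaggedPartition.snoc {a b : ℝ} (P : TaggedPartition a b) (c τ : ℝ) (hbc : b < c)
    (hτ : τ ∈ Icc b c) : TaggedPartition a c where
  size := P.size + 1
  pt := fun j => if j ≤ P.size then P.pt j else c
  tag := fun j => if j < P.size then P.tag j else τ
  pt_zero := by simp [P.pt_zero]
  pt_size := by simp
  pt_lt := by
    intro j hj
    rcases Nat.lt_succ_iff_lt_or_eq.1 hj with h | rfl
    · simpa [h.le, Nat.succ_le_of_lt h] using P.pt_lt j h
    · simpa [P.pt_size] using hbc
  tag_mem := by
    intro j hj
    rcases Nat.lt_succ_iff_lt_or_eq.1 hj with h | rfl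
    · simpa [h, h.le, Nat.succ_le_of_lt h] using P.tag_mem j h
    · simpa [P.pt_size] using hτ

theorem TaggedPartition.IsFine.snoc {a b : ℝ} {P : TaggedPartition a b} {δ : ℝ → ℝ}
    (hP : P.IsFine δ) (c τ : ℝ) (hbc : b < c) (hτ : τ ∈ Icc b c)
    (h : Icc b c ⊆ Ioo (τ - δ τ) (τ + δ τ)) : (P.snoc c τ hbc hτ).IsFine δ := by
  intro j hj
  rcases Nat.lt_succ_iff_lt_or_eq.1 hj with h' | rfl
  · simpa [TaggedPartition.snoc, h', h'.le, Nat.succ_le_of_lt h'] using hP j h'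
  · simpa [TaggedPartition.snoc, P.pt_size] using h

/-- Fine tagged partitions exist for every gauge (Cousin's lemma). -/
theorem exists_isFine {a b : ℝ} (hab : a ≤ b) (δ : ℝ → ℝ) (hδ : ∀ t ∈ Icc a b, 0 < δ t) :
    ∃ P : TaggedPartition a b, P.IsFine δ := by
  let S : Set ℝ := {c | c ∈ Icc a b ∧ ∃ P : TaggedPartition a c, P.IsFine δ}
  have haS : a ∈ S := ⟨⟨le_rfl, hab⟩, ⟨0, fun _ => a, fun _ => a, rfl, rfl, by simp, by simp⟩,
    fun j hj => by simp at hj⟩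
  have hbdd : BddAbove S := ⟨b, fun c hc => hc.1.2⟩
  set c := sSup S with hc
  have hac : a ≤ c := le_csSup hbdd haS
  have hcb : c ≤ b := csSup_le ⟨a, haS⟩ fun x hx => hx.1.2
  have hδc := hδ c ⟨hac, hcb⟩
  have hcS : c ∈ S := by
    obtain ⟨d, hd, hdc⟩ := exists_lt_of_lt_csSup ⟨a, haS⟩ (show c - δ c < sSup S by linarith)
    rcases (le_csSup hbdd hd).eq_or_lt with h | h
    · exact hc ▸ h ▸ hd
    · obtain ⟨P, hP⟩ := hd.2
      refine ⟨⟨hac, hcb⟩, P.snoc c c h ⟨h.le, le_rfl⟩, hP.snoc c c h ⟨h.le, le_rfl⟩ ?_⟩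
      intro x hx
      exact ⟨by linarith [hx.1], by linarith [hx.2]⟩
  rcases hcb.eq_or_lt with h | h
  · exact h ▸ hcS.2
  · exfalso
    obtain ⟨P, hP⟩ := hcS.2
    have hlt : c < min b (c + δ c / 2) := lt_min h (by linarith)
    have hmem : min b (c + δ c / 2) ∈ S := by
      refine ⟨⟨hac.trans hlt.le, min_le_left _ _⟩, P.snoc _ c hlt ⟨le_rfl, hlt.le⟩,
        hP.snoc _ c hlt ⟨le_rfl, hlt.le⟩ ?_⟩
      intro x hx
      have := hx.2.trans (min_le_right _ _)
      exact ⟨by linarith [hx.1], by linarith⟩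
    exact absurd (le_csSup hbdd hmem) (not_le.2 hlt)

/-- The Kurzweil integral is unique. -/
theorem HasKurzweilIntegral.unique {G : ℝ → ℝ → X} {a b : ℝ} (hab : a ≤ b) {I J : X}
    (hI : HasKurzweilIntegral G a b I) (hJ : HasKurzweilIntegral G a b J) : I = J := by
  by_contra hne
  have hpos : 0 < ‖I - J‖ / 2 := half_pos (norm_pos_iff.2 (sub_ne_zero.2 hne))
  obtain ⟨δ₁, h₁, H₁⟩ := hI _ hpos
  obtain ⟨δ₂, h₂, H₂⟩ := hJ _ hpos
  obtain ⟨P, hP⟩ := exists_isFine hab (fun t => min (δ₁ t) (δ₂ t))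
    fun t ht => lt_min (h₁ t ht) (h₂ t ht)
  have k₁ := H₁ P fun j hj => (hP j hj).trans
    (Ioo_subset_Ioo (sub_le_sub_left (min_le_left _ _) _) (add_le_add_right (min_le_left _ _) _))
  have k₂ := H₂ P fun j hj => (hP j hj).trans
    (Ioo_subset_Ioo (sub_le_sub_left (min_le_right _ _) _)
      (add_le_add_right (min_le_right _ _) _))
  have := norm_sub_le (P.sum G - J) (P.sum G - I)
  rw [sub_sub_sub_cancel_left] at this
  linarith

theorem HasKurzweilIntegral.integral_eq {G : ℝ → ℝ → X} {a b : ℝ} (hab : a ≤ b) {I : X}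
    (hI : HasKurzweilIntegral G a b I) : kurzweilIntegral G a b = I := by
  have h : KurzweilIntegrable G a b := ⟨I, hI⟩
  rw [kurzweilIntegral, if_pos hab, dif_pos h]
  exact h.choose_spec.unique hab hI

end Kurzweil

section Equation

variable {E : Type*} [NormedAddCommGroup E] [NormedSpace ℝ E]

/-- Condition (D): `I - Δ⁻A(t)` is invertible for `t > 0` and `I + Δ⁺A(t)` is invertible for
`t ≥ 0`, where `Δ⁻A(t) = A(t) - A(t⁻)` and `Δ⁺A(t) = A(t⁺) - A(t)`. -/
def ConditionD (A : ℝ → E →L[ℝ] E) : Prop :=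
  (∀ t > 0, IsUnit (1 - (A t - Function.leftLim A t))) ∧
    ∀ t ≥ 0, IsUnit (1 + (Function.rightLim A t - A t))

/-- `x` is a solution on the interval `J` of the homogeneous equation `dx/dτ = D[A(t)x]`:
`x(d) - x(c) = ∫_c^d d[A(s)] x(s)` whenever `[c, d] ⊆ J`. -/
def IsSolutionOn (A : ℝ → E →L[ℝ] E) (J : Set ℝ) (x : ℝ → E) : Prop :=
  ∀ c d, c ≤ d → Icc c d ⊆ J →
    HasKurzweilIntegral (fun τ t => A t (x τ)) c d (x d - x c)

/-- `U` is a transition matrix on `[0, ∞)`: for all `t, s ≥ 0` (in either order) the integral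
exists and `U(t, s) = I + ∫_s^t d[A(r)] U(r, s)`. -/
def IsTransitionMatrix (A : ℝ → E →L[ℝ] E) (U : ℝ → ℝ → E →L[ℝ] E) : Prop :=
  ∀ t ≥ 0, ∀ s ≥ 0,
    KurzweilIntegrable (fun τ r => A r * U τ s) (min s t) (max s t) ∧
      U t s = 1 + kurzweilIntegral (fun τ r => A r * U τ s) s t

/-- `‖U(t, s)‖ ≤ K e^{-α (t - s)}` for all `t ≥ s ≥ 0`, for some `K, α > 0`. -/
def HasUniformExponentialDecay (U : ℝ → ℝ → E →L[ℝ] E) : Prop :=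
  ∃ K > 0, ∃ α > 0, ∀ s ≥ 0, ∀ t ≥ s, ‖U t s‖ ≤ K * Real.exp (-α * (t - s))

/-- Uniform stability of the trivial solution. -/
def UniformlyStable (A : ℝ → E →L[ℝ] E) : Prop :=
  ∀ ε > 0, ∃ δ > 0, ∀ s₀ ≥ 0, ∀ x : ℝ → E, IsSolutionOn A (Ici s₀) x → ‖x s₀‖ < δ →
    ∀ t ≥ s₀, ‖x t‖ < ε

/-- Uniform asymptotic stability of the trivial solution. -/
def UniformlyAsymptoticallyStable (A : ℝ → E →L[ℝ] E) : Prop :=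
  UniformlyStable A ∧
    ∃ δ₀ > 0, ∀ ε > 0, ∃ T ≥ 0, ∀ s₀ ≥ 0, ∀ x : ℝ → E, IsSolutionOn A (Ici s₀) x →
      ‖x s₀‖ < δ₀ → ∀ t ≥ s₀ + T, ‖x t‖ < ε

/-- Global uniform exponential stability of the trivial solution. -/
def GloballyUniformlyExponentiallyStable (A : ℝ → E →L[ℝ] E) : Prop :=
  ∃ K > 0, ∃ α > 0, ∀ s₀ ≥ 0, ∀ x : ℝ → E, IsSolutionOn A (Ici s₀) x →
    ∀ t ≥ s₀, ‖x t‖ ≤ K * ‖x s₀‖ * Real.exp (-α * (t - s₀))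

/-- The total variation
`sup_{t ≥ s₀} var_{s₀}^t (y(s) - ∫_{s₀}^s d[A(ξ)] y(ξ))`. -/
noncomputable def defectVariation (A : ℝ → E →L[ℝ] E) (s₀ : ℝ) (y : ℝ → E) : ENNReal :=
  ⨆ t ≥ s₀, eVariationOn
    (fun s => y s - kurzweilIntegral (fun τ r => A r (y τ)) s₀ s) (Icc s₀ t)

/-- The test functions of variational stability: locally of bounded variation on `[s₀, ∞)` and
left-continuous on `(s₀, ∞)`. -/
def IsAdmissible (s₀ : ℝ) (y : ℝ → E) : Prop :=
  LocallyBoundedVariationOn y (Ici s₀) ∧ ∀ t > s₀, ContinuousWithinAt y (Iio t) t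

/-- Variational stability of the trivial solution. -/
def VariationallyStable (A : ℝ → E →L[ℝ] E) : Prop :=
  ∀ ε > 0, ∃ δ > 0, ∀ s₀ ≥ 0, ∀ y : ℝ → E, IsAdmissible s₀ y → ‖y s₀‖ < δ →
    defectVariation A s₀ y < ENNReal.ofReal δ → ∀ t ≥ s₀, ‖y t‖ < ε

/-- Variational attractivity of the trivial solution. -/
def VariationallyAttracting (A : ℝ → E →L[ℝ] E) : Prop :=
  ∃ δ₀ > 0, ∀ ε > 0, ∃ T ≥ 0, ∃ γ > 0, ∀ s₀ ≥ 0, ∀ y : ℝ → E, IsAdmissible s₀ y →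
    ‖y s₀‖ < δ₀ → defectVariation A s₀ y < ENNReal.ofReal γ → ∀ t ≥ s₀ + T, ‖y t‖ < ε

/-- Variational asymptotic stability of the trivial solution. -/
def VariationallyAsymptoticallyStable (A : ℝ → E →L[ℝ] E) : Prop :=
  VariationallyStable A ∧ VariationallyAttracting A

end Equation

end GLDE

/-!
A function locally of bounded variation and left-continuous is controlled by a monotone
left-continuous `v`, and the Kurzweil integral is a limit along the filter of fine partitions, so
local estimates of the increments of `G(τ, ·)` near each `τ` sum up to estimates of integrals.

Against the weight `exp (2 (v t - v s))` integration contracts by `1 / 2`, which gives existence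
and uniqueness of forward solutions `X` of `dX/dτ = D[A(t)X]`. Going forward, `X` stays
invertible: `X(t)` is close to `X(c)` for `c < t` near `t`, and `X(t⁺) = (I + Δ⁺A(t)) X(t)`. So
`U(t, s) = X(t) X(s)⁻¹`.

If `y` is arbitrary, `y(t) - U(t, s) y(s)` is bounded by a constant times the variation of
`y - ∫ d[A] y`. The bound is proved on short intervals, where `v` grows by at most `1 / 2` after
its jump at the left endpoint, and such intervals are chained by the transition property of `U`.
The implications between the stability notions then run in cycles: variational asymptotic
stability contains uniform asymptotic stability because solutions have zero defect; the latter
makes `‖U(s + T, s)‖ ≤ 1 / 2` for some `T`, hence exponential decay; and decay with the bound on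
`y(t) - U(t, s) y(s)` returns variational asymptotic stability.
-/

namespace GLDE

section FinePartitions

variable {X Y : Type*} [NormedAddCommGroup X] [NormedAddCommGroup Y] {a b c : ℝ}

namespace TaggedPartition

theorem pt_mem_Icc (P : TaggedPartition a b) {j : ℕ} (hj : j ≤ P.size) : P.pt j ∈ Icc a b := by
  have hmono : MonotoneOn P.pt (Iic P.size) :=
    monotoneOn_of_le_succ ordConnected_Iic fun k _ _ hk => (P.pt_lt k (Nat.lt_of_succ_le hk)).le
  constructor
  · simpa only [P.pt_zero] using hmono (mem_Iic.2 (Nat.zero_le _)) hj (Nat.zero_le j)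
  · simpa only [P.pt_size] using hmono hj self_mem_Iic hj

theorem tag_mem_Icc (P : TaggedPartition a b) {j : ℕ} (hj : j < P.size) : P.tag j ∈ Icc a b :=
  ⟨(P.pt_mem_Icc hj.le).1.trans (P.tag_mem j hj).1, (P.tag_mem j hj).2.trans (P.pt_mem_Icc hj).2⟩

theorem sum_add (P : TaggedPartition a b) (G H : ℝ → ℝ → X) :
    P.sum (fun τ t => G τ t + H τ t) = P.sum G + P.sum H := by
  simp only [TaggedPartition.sum, add_sub_add_comm, Finset.sum_add_distrib]

theorem sum_sub (P : TaggedPartition a b) (G H : ℝ → ℝ → X) :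
    P.sum (fun τ t => G τ t - H τ t) = P.sum G - P.sum H := by
  simp only [TaggedPartition.sum, sub_sub_sub_comm, Finset.sum_sub_distrib]

theorem sum_map {𝓕 : Type*} [FunLike 𝓕 X Y] [AddMonoidHomClass 𝓕 X Y] (L : 𝓕)
    (P : TaggedPartition a b) (G : ℝ → ℝ → X) : P.sum (fun τ t => L (G τ t)) = L (P.sum G) := by
  simp only [TaggedPartition.sum, map_sum, map_sub]

theorem sum_congr (P : TaggedPartition a b) {G H : ℝ → ℝ → X}
    (h : ∀ τ ∈ Icc a b, ∀ t ∈ Icc a b, G τ t = H τ t) : P.sum G = P.sum H := by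
  refine Finset.sum_congr rfl fun j hj => ?_
  have hj := Finset.mem_range.1 hj
  rw [h _ (P.tag_mem_Icc hj) _ (P.pt_mem_Icc hj), h _ (P.tag_mem_Icc hj) _ (P.pt_mem_Icc hj.le)]

theorem sum_increments (P : TaggedPartition a b) (F : ℝ → X) :
    ∑ j ∈ Finset.range P.size, (F (P.pt (j + 1)) - F (P.pt j)) = F b - F a := by
  rw [Finset.sum_range_sub (fun j => F (P.pt j)), P.pt_size, P.pt_zero]

theorem norm_sum_sub_le (P : TaggedPartition a b) {G : ℝ → ℝ → X} {F : ℝ → X} {μ : ℝ → ℝ}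
    (h : ∀ j < P.size, ‖G (P.tag j) (P.pt (j + 1)) - G (P.tag j) (P.pt j)
      - (F (P.pt (j + 1)) - F (P.pt j))‖ ≤ μ (P.pt (j + 1)) - μ (P.pt j)) :
    ‖P.sum G - (F b - F a)‖ ≤ μ b - μ a := by
  rw [← P.sum_increments F, ← P.sum_increments μ, TaggedPartition.sum, ← Finset.sum_sub_distrib]
  exact norm_sum_le_of_le _ fun j hj => h j (Finset.mem_range.1 hj)

theorem snoc_sum (P : TaggedPartition a b) {τ : ℝ} (hbc : b < c) (hτ : τ ∈ Icc b c)
    (G : ℝ → ℝ → X) : (P.snoc c τ hbc hτ).sum G = P.sum G + (G τ c - G τ b) := by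
  simp only [TaggedPartition.sum, snoc, Finset.sum_range_succ]
  congr 1
  · refine Finset.sum_congr rfl fun j hj => ?_
    have hj := Finset.mem_range.1 hj
    simp [hj, hj.le, Nat.succ_le_of_lt hj]
  · simp [P.pt_size]

/-- Concatenation of tagged partitions of `[a, b]` and `[b, c]`. -/
def append (P : TaggedPartition a b) (Q : TaggedPartition b c) : TaggedPartition a c where
  size := P.size + Q.size
  pt := fun j => if j < P.size then P.pt j else Q.pt (j - P.size)
  tag := fun j => if j < P.size then P.tag j else Q.tag (j - P.size)
  pt_zero := by
    split_ifs with h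
    · exact P.pt_zero
    · have hab : b = a :=
        P.pt_size.symm.trans ((congrArg P.pt (Nat.eq_zero_of_not_pos h)).trans P.pt_zero)
      simp [Q.pt_zero, hab]
  pt_size := by simp [Q.pt_size]
  pt_lt := by
    intro j hj
    rcases lt_trichotomy (j + 1) P.size with h | h | h
    · simpa [h, (Nat.lt_succ_self j).trans h] using P.pt_lt j (by omega)
    · simpa [h, show j < P.size by omega, Q.pt_zero, P.pt_size] using P.pt_lt j (by omega)
    · simpa [show ¬ j < P.size by omega, show ¬ j + 1 < P.size by omega,
        show j - P.size + 1 = j + 1 - P.size by omega] using Q.pt_lt (j - P.size) (by omega)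
  tag_mem := by
    intro j hj
    rcases lt_trichotomy (j + 1) P.size with h | h | h
    · simpa [h, (Nat.lt_succ_self j).trans h] using P.tag_mem j (by omega)
    · simpa [h, show j < P.size by omega, Q.pt_zero, P.pt_size] using P.tag_mem j (by omega)
    · simpa [show ¬ j < P.size by omega, show ¬ j + 1 < P.size by omega,
        show j - P.size + 1 = j + 1 - P.size by omega] using Q.tag_mem (j - P.size) (by omega)

theorem append_pt_left (P : TaggedPartition a b) (Q : TaggedPartition b c) {j : ℕ}
    (hj : j ≤ P.size) : (P.append Q).pt j = P.pt j := by
  rcases hj.lt_or_eq with h | rfl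
  · simp [append, h]
  · simp [append, P.pt_size, Q.pt_zero]

theorem append_pt_right (P : TaggedPartition a b) (Q : TaggedPartition b c) (j : ℕ) :
    (P.append Q).pt (P.size + j) = Q.pt j := by
  simp [append]

theorem append_tag_left (P : TaggedPartition a b) (Q : TaggedPartition b c) {j : ℕ}
    (hj : j < P.size) : (P.append Q).tag j = P.tag j := by
  simp [append, hj]

theorem append_tag_right (P : TaggedPartition a b) (Q : TaggedPartition b c) (j : ℕ) :
    (P.append Q).tag (P.size + j) = Q.tag j := by
  simp [append]

theorem append_sum (P : TaggedPartition a b) (Q : TaggedPartition b c) (G : ℝ → ℝ → X) :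
    (P.append Q).sum G = P.sum G + Q.sum G := by
  have hsize : (P.append Q).size = P.size + Q.size := rfl
  simp only [TaggedPartition.sum, hsize, Finset.sum_range_add]
  congr 1
  · refine Finset.sum_congr rfl fun j hj => ?_
    have hj := Finset.mem_range.1 hj
    rw [append_pt_left _ _ (by omega), append_pt_left _ _ (by omega), append_tag_left _ _ hj]
  · refine Finset.sum_congr rfl fun j _ => ?_
    rw [add_assoc, append_pt_right, append_pt_right, append_tag_right]

theorem IsFine.append {P : TaggedPartition a b} {Q : TaggedPartition b c} {δ : ℝ → ℝ}
    (hP : P.IsFine δ) (hQ : Q.IsFine δ) : (P.append Q).IsFine δ := by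
  intro j hj
  rcases lt_or_ge j P.size with h | h
  · rw [append_pt_left _ _ (by omega), append_pt_left _ _ (by omega), append_tag_left _ _ h]
    exact hP j h
  · obtain ⟨k, rfl⟩ := Nat.exists_eq_add_of_le h
    rw [add_assoc, append_pt_right, append_pt_right, append_tag_right]
    exact hQ k (Nat.lt_of_add_lt_add_left hj)

theorem IsFine.mono {P : TaggedPartition a b} {δ δ' : ℝ → ℝ} (hP : P.IsFine δ)
    (h : ∀ t, δ t ≤ δ' t) : P.IsFine δ' := fun j hj =>
  (hP j hj).trans (Ioo_subset_Ioo (sub_le_sub_left (h _) _) (add_le_add_right (h _) _))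

end TaggedPartition

/-- The filter on the tagged partitions of `[a, b]` along which Kurzweil integrals are limits of
sums: it is generated by the sets of `δ`-fine partitions, for `δ` positive on `[a, b]`. -/
def fineFilter (a b : ℝ) : Filter (TaggedPartition a b) :=
  ⨅ δ ∈ {δ : ℝ → ℝ | ∀ t ∈ Icc a b, 0 < δ t}, 𝓟 {P | P.IsFine δ}

theorem hasBasis_fineFilter (a b : ℝ) :
    (fineFilter a b).HasBasis (fun δ : ℝ → ℝ => ∀ t ∈ Icc a b, 0 < δ t)
      fun δ => {P | P.IsFine δ} := by
  refine hasBasis_biInf_principal (fun δ₁ h₁ δ₂ h₂ => ?_) ⟨fun _ => 1, fun _ _ => one_pos⟩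
  exact ⟨fun t => min (δ₁ t) (δ₂ t), fun t ht => lt_min (h₁ t ht) (h₂ t ht),
    fun P (hP : P.IsFine _) => hP.mono fun _ => min_le_left _ _,
    fun P (hP : P.IsFine _) => hP.mono fun _ => min_le_right _ _⟩

theorem eventually_isFine {δ : ℝ → ℝ} (hδ : ∀ t ∈ Icc a b, 0 < δ t) :
    ∀ᶠ P in fineFilter a b, P.IsFine δ :=
  (hasBasis_fineFilter a b).mem_of_mem hδ

theorem fineFilter_neBot (hab : a ≤ b) : (fineFilter a b).NeBot :=
  (hasBasis_fineFilter a b).neBot_iff.2 fun hδ => exists_isFine hab _ hδ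

theorem tendsto_append (hab : a ≤ b) (hbc : b ≤ c) :
    Tendsto (fun p : TaggedPartition a b × TaggedPartition b c => p.1.append p.2)
      (fineFilter a b ×ˢ fineFilter b c) (fineFilter a c) :=
  (hasBasis_fineFilter a c).tendsto_right_iff.2 fun _ hδ =>
    ((eventually_isFine fun t ht => hδ t (Icc_subset_Icc_right hbc ht)).prod_mk
      (eventually_isFine fun t ht => hδ t (Icc_subset_Icc_left hab ht))).mono
        fun _ hp => hp.1.append hp.2

theorem eventually_fineFilter_of_local {r : ℝ → ℝ → ℝ → Prop}
    (h : ∀ τ ∈ Icc a b, ∀ᶠ p in 𝓝[Icc a τ] τ ×ˢ 𝓝[Icc τ b] τ, r τ p.1 p.2) :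
    ∀ᶠ P in fineFilter a b, ∀ j < P.size, r (P.tag j) (P.pt j) (P.pt (j + 1)) := by
  have hball : ∀ τ ∈ Icc a b, ∃ δ > 0, ∀ p ∈ Icc a τ, ∀ q ∈ Icc τ b,
      τ - δ < p → q < τ + δ → r τ p q := by
    intro τ hτ
    have hτr := h τ hτ
    rw [← nhdsWithin_prod_eq] at hτr
    obtain ⟨δ, hδ, hr⟩ := Metric.mem_nhdsWithin_iff.1 hτr
    refine ⟨δ, hδ, fun p hp q hq hpδ hqδ => @hr (p, q) ⟨?_, hp, hq⟩⟩
    rw [← ball_prod_same, Real.ball_eq_Ioo]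
    exact ⟨⟨hpδ, by linarith [hp.2]⟩, by linarith [hq.1], hqδ⟩
  choose! δ hδ hr using hball
  filter_upwards [eventually_isFine hδ] with P hP j hj
  have hlt := P.pt_lt j hj
  have htag := P.tag_mem j hj
  exact hr _ (P.tag_mem_Icc hj) _ ⟨(P.pt_mem_Icc hj.le).1, htag.1⟩ _
    ⟨htag.2, (P.pt_mem_Icc hj).2⟩ (hP j hj ⟨le_rfl, hlt.le⟩).1 (hP j hj ⟨hlt.le, le_rfl⟩).2

theorem interval_induction (hab : a ≤ b) {R : ℝ → ℝ → Prop}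
    (trans : ∀ c m d, a ≤ c → c ≤ m → m ≤ d → d ≤ b → R c m → R m d → R c d)
    (left : ∀ τ ∈ Icc a b, ∀ᶠ c in 𝓝[Icc a τ] τ, R c τ)
    (right : ∀ τ ∈ Icc a b, ∀ᶠ d in 𝓝[Icc τ b] τ, R τ d) : R a b := by
  have := fineFilter_neBot hab
  obtain ⟨P, hP⟩ := (eventually_fineFilter_of_local (r := fun τ c d => R c τ ∧ R τ d)
    fun τ hτ => (left τ hτ).prod_mk (right τ hτ)).exists
  have refl : R a a := (left a (left_mem_Icc.2 hab)).self_of_nhdsWithin (right_mem_Icc.2 le_rfl)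
  have key : ∀ j ≤ P.size, R a (P.pt j) := by
    intro j
    induction j with
    | zero => exact fun _ => P.pt_zero.symm ▸ refl
    | succ k ih =>
      intro hk
      have htag := P.tag_mem k hk
      have hpt := P.pt_mem_Icc (Nat.le_of_succ_le hk)
      have hpt' := P.pt_mem_Icc hk
      exact trans _ _ _ le_rfl hpt.1 (htag.1.trans htag.2) hpt'.2 (ih (Nat.le_of_succ_le hk))
        (trans _ _ _ hpt.1 htag.1 htag.2 hpt'.2 (hP k hk).1 (hP k hk).2)
  simpa only [P.pt_size] using key P.size le_rfl

end FinePartitions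

section KurzweilIntegral

variable {X Y : Type*} [NormedAddCommGroup X] [NormedAddCommGroup Y] {G H : ℝ → ℝ → X}
  {a b c : ℝ} {I J : X}

theorem hasKurzweilIntegral_iff_tendsto :
    HasKurzweilIntegral G a b I ↔ Tendsto (fun P => P.sum G) (fineFilter a b) (𝓝 I) := by
  simp only [(hasBasis_fineFilter a b).tendsto_iff Metric.nhds_basis_ball, mem_ball_iff_norm]
  rfl

theorem HasKurzweilIntegral.tendsto (h : HasKurzweilIntegral G a b I) :
    Tendsto (fun P => P.sum G) (fineFilter a b) (𝓝 I) :=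
  hasKurzweilIntegral_iff_tendsto.1 h

theorem HasKurzweilIntegral.congr (hG : HasKurzweilIntegral G a b I)
    (h : ∀ τ ∈ Icc a b, ∀ t ∈ Icc a b, G τ t = H τ t) : HasKurzweilIntegral H a b I :=
  hasKurzweilIntegral_iff_tendsto.2 (hG.tendsto.congr fun P => P.sum_congr h)

theorem HasKurzweilIntegral.add (hG : HasKurzweilIntegral G a b I)
    (hH : HasKurzweilIntegral H a b J) :
    HasKurzweilIntegral (fun τ t => G τ t + H τ t) a b (I + J) := by
  simpa only [hasKurzweilIntegral_iff_tendsto, TaggedPartition.sum_add]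
    using hG.tendsto.add hH.tendsto

theorem HasKurzweilIntegral.sub (hG : HasKurzweilIntegral G a b I)
    (hH : HasKurzweilIntegral H a b J) :
    HasKurzweilIntegral (fun τ t => G τ t - H τ t) a b (I - J) := by
  simpa only [hasKurzweilIntegral_iff_tendsto, TaggedPartition.sum_sub]
    using hG.tendsto.sub hH.tendsto

theorem HasKurzweilIntegral.map [NormedSpace ℝ X] [NormedSpace ℝ Y] (L : X →L[ℝ] Y)
    (hG : HasKurzweilIntegral G a b I) : HasKurzweilIntegral (fun τ t => L (G τ t)) a b (L I) := by
  simpa only [hasKurzweilIntegral_iff_tendsto, TaggedPartition.sum_map, Function.comp_def]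
    using (L.continuous.tendsto I).comp hG.tendsto

theorem hasKurzweilIntegral_const (f : ℝ → X) (a b : ℝ) :
    HasKurzweilIntegral (fun _ t => f t) a b (f b - f a) :=
  hasKurzweilIntegral_iff_tendsto.2
    (tendsto_const_nhds.congr fun P => (P.sum_increments f).symm)

theorem HasKurzweilIntegral.finset_sum {ι : Type*} (s : Finset ι) {G : ι → ℝ → ℝ → X} {I : ι → X}
    (h : ∀ i ∈ s, HasKurzweilIntegral (G i) a b (I i)) :
    HasKurzweilIntegral (fun τ t => ∑ i ∈ s, G i τ t) a b (∑ i ∈ s, I i) := by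
  refine hasKurzweilIntegral_iff_tendsto.2
    ((tendsto_finsetSum s fun i hi => (h i hi).tendsto).congr fun P => ?_)
  simp only [TaggedPartition.sum, ← Finset.sum_sub_distrib, Finset.sum_comm (s := s)]

theorem hasKurzweilIntegral_self (G : ℝ → ℝ → X) (a : ℝ) : HasKurzweilIntegral G a a 0 := by
  refine HasKurzweilIntegral.congr (G := fun _ _ => G a a) ?_ fun τ hτ t ht => ?_
  · simpa only [sub_self] using hasKurzweilIntegral_const (fun _ => G a a) a a
  · rw [Icc_self, mem_singleton_iff] at hτ ht
    rw [hτ, ht]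

theorem kurzweilIntegral_self (G : ℝ → ℝ → X) (s : ℝ) : kurzweilIntegral G s s = 0 :=
  (hasKurzweilIntegral_self G s).integral_eq le_rfl

theorem kurzweilIntegral_symm (G : ℝ → ℝ → X) (a b : ℝ) :
    kurzweilIntegral G b a = -kurzweilIntegral G a b := by
  rcases lt_trichotomy a b with h | rfl | h
  · simp only [kurzweilIntegral, h.le, not_le.2 h, if_true, if_false]
    split_ifs <;> simp
  · rw [kurzweilIntegral_self, neg_zero]
  · simp only [kurzweilIntegral, h.le, not_le.2 h, if_true, if_false]
    split_ifs <;> simp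

theorem exists_tendsto_of_forall_approx {α : Type*} [CompleteSpace X] {l : Filter α} [l.NeBot]
    {f : α → X} (h : ∀ ε > 0, ∃ g : α → X, (∃ I, Tendsto g l (𝓝 I)) ∧ ∀ᶠ x in l, ‖f x - g x‖ < ε) :
    ∃ I, Tendsto f l (𝓝 I) := by
  refine cauchy_map_iff_exists_tendsto.1 (Metric.cauchy_iff.2 ⟨inferInstance, fun ε hε => ?_⟩)
  obtain ⟨g, ⟨I, hg⟩, hfg⟩ := h (ε / 4) (by positivity)
  have hclose : ∀ᶠ x in l, dist (f x) I < ε / 2 := by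
    filter_upwards [hfg, hg.eventually (Metric.ball_mem_nhds I (show 0 < ε / 4 by positivity))]
      with x hx hxI
    rw [← dist_eq_norm] at hx
    linarith [dist_triangle (f x) (g x) I, Metric.mem_ball.1 hxI]
  refine ⟨_, image_mem_map hclose, ?_⟩
  rintro _ ⟨x, hx, rfl⟩ _ ⟨y, hy, rfl⟩
  linarith [dist_triangle_right (f x) (f y) I, mem_ofPred.1 hx, mem_ofPred.1 hy]

theorem kurzweilIntegrable_of_approx [CompleteSpace X] (hab : a ≤ b)
    (h : ∀ ε > 0, ∃ H : ℝ → ℝ → X, KurzweilIntegrable H a b ∧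
      ∀ P : TaggedPartition a b, ‖P.sum G - P.sum H‖ < ε) : KurzweilIntegrable G a b := by
  have := fineFilter_neBot hab
  simp only [KurzweilIntegrable, hasKurzweilIntegral_iff_tendsto] at h ⊢
  refine exists_tendsto_of_forall_approx fun ε hε => ?_
  obtain ⟨H, hH, hGH⟩ := h ε hε
  exact ⟨_, hH, Eventually.of_forall hGH⟩

theorem exists_tendsto_of_tendsto_add {α β : Type*} [CompleteSpace X] {l : Filter α}
    {l' : Filter β} [l.NeBot] [l'.NeBot] {f : α → X} {g : β → X}
    (h : Tendsto (fun p : α × β => f p.1 + g p.2) (l ×ˢ l') (𝓝 I)) :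
    ∃ J K, Tendsto f l (𝓝 J) ∧ Tendsto g l' (𝓝 K) ∧ J + K = I := by
  obtain ⟨J, hJ⟩ : ∃ J, Tendsto f l (𝓝 J) := by
    refine exists_tendsto_of_forall_approx fun ε hε => ?_
    obtain ⟨y, hy⟩ :=
      ((h.comp tendsto_prod_swap).eventually (Metric.ball_mem_nhds I hε)).curry.exists
    refine ⟨fun _ => I - g y, ⟨_, tendsto_const_nhds⟩, hy.mono fun x hx => ?_⟩
    rw [sub_sub_eq_add_sub]
    exact mem_ball_iff_norm.1 hx
  have hK : Tendsto g l' (𝓝 (I - J)) := by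
    have hsum : Tendsto (g ∘ Prod.snd) (l ×ˢ l') (𝓝 (I - J)) := by
      simpa only [Function.comp_def, add_sub_cancel_left] using h.sub (hJ.comp tendsto_fst)
    rwa [← tendsto_map'_iff, map_snd_prod] at hsum
  exact ⟨J, I - J, hJ, hK, add_sub_cancel J I⟩

theorem HasKurzweilIntegral.exists_split [CompleteSpace X] (hab : a ≤ b) (hbc : b ≤ c)
    (hI : HasKurzweilIntegral G a c I) :
    ∃ J K, HasKurzweilIntegral G a b J ∧ HasKurzweilIntegral G b c K ∧ J + K = I := by
  have := fineFilter_neBot hab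
  have := fineFilter_neBot hbc
  simp only [hasKurzweilIntegral_iff_tendsto]
  refine exists_tendsto_of_tendsto_add ?_
  simpa only [Function.comp_def, TaggedPartition.append_sum]
    using hI.tendsto.comp (tendsto_append hab hbc)

theorem KurzweilIntegrable.hasKurzweilIntegral_sub_of_base_le [CompleteSpace X] {s d : ℝ}
    (h : KurzweilIntegrable G s d) (hsc : s ≤ c) (hcd : c ≤ d) :
    HasKurzweilIntegral G c d (kurzweilIntegral G s d - kurzweilIntegral G s c) := by
  obtain ⟨I, hI⟩ := h
  obtain ⟨J, K, hJ, hK, rfl⟩ := hI.exists_split hsc hcd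
  rwa [hI.integral_eq (hsc.trans hcd), hJ.integral_eq hsc, add_sub_cancel_left]

theorem KurzweilIntegrable.hasKurzweilIntegral_sub_of_le_base [CompleteSpace X] {s d : ℝ}
    (h : KurzweilIntegrable G c s) (hcd : c ≤ d) (hds : d ≤ s) :
    HasKurzweilIntegral G c d (kurzweilIntegral G s d - kurzweilIntegral G s c) := by
  obtain ⟨I, hI⟩ := h
  obtain ⟨J, K, hJ, hK, rfl⟩ := hI.exists_split hcd hds
  rwa [kurzweilIntegral_symm G d s, kurzweilIntegral_symm G c s, hI.integral_eq (hcd.trans hds),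
    hK.integral_eq hds, sub_neg_eq_add, neg_add_eq_sub, add_sub_cancel_right]

/-- Near each point `τ` of `[a, b]`, the increments of `G τ` differ from those of `F` by at most
the increments of `μ`. Summed over fine partitions, this compares the integral of `G` with the
increment of `F`. -/
def LocallyApprox (G : ℝ → ℝ → X) (F : ℝ → X) (μ : ℝ → ℝ) (a b : ℝ) : Prop :=
  ∀ τ ∈ Icc a b, ∀ᶠ p in 𝓝[Icc a τ] τ ×ˢ 𝓝[Icc τ b] τ,
    ‖G τ p.2 - G τ p.1 - (F p.2 - F p.1)‖ ≤ μ p.2 - μ p.1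

theorem LocallyApprox.eventually_norm_sum_sub_le {F : ℝ → X} {μ : ℝ → ℝ}
    (h : LocallyApprox G F μ a b) :
    ∀ᶠ P in fineFilter a b, ‖P.sum G - (F b - F a)‖ ≤ μ b - μ a :=
  (eventually_fineFilter_of_local (r := fun τ p q => ‖G τ q - G τ p - (F q - F p)‖ ≤ μ q - μ p)
    h).mono fun P hP => P.norm_sum_sub_le hP

theorem hasKurzweilIntegral_of_locallyApprox {F : ℝ → X}
    (h : ∀ ε > 0, ∃ μ : ℝ → ℝ, μ b - μ a < ε ∧ LocallyApprox G F μ a b) :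
    HasKurzweilIntegral G a b (F b - F a) := by
  refine hasKurzweilIntegral_iff_tendsto.2 (Metric.tendsto_nhds.2 fun ε hε => ?_)
  obtain ⟨μ, hμ, hG⟩ := h ε hε
  filter_upwards [hG.eventually_norm_sum_sub_le] with P hP
  exact (dist_eq_norm _ _).trans_lt (hP.trans_lt hμ)

theorem HasKurzweilIntegral.norm_le_of_locallyApprox {C : ℝ} (hab : a ≤ b)
    (hI : HasKurzweilIntegral G a b I)
    (h : ∀ η > 0, ∃ μ : ℝ → ℝ, μ b - μ a ≤ C + η ∧ LocallyApprox G (fun _ => 0) μ a b) :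
    ‖I‖ ≤ C := by
  have := fineFilter_neBot hab
  refine le_of_forall_pos_le_add fun η hη => ?_
  obtain ⟨μ, hμ, hG⟩ := h η hη
  refine le_of_tendsto hI.tendsto.norm (hG.eventually_norm_sum_sub_le.mono fun P hP => ?_)
  simpa only [sub_zero] using hP.trans hμ

theorem norm_sub_le_of_forall_isFine {F : ℝ → X} {δ : ℝ → ℝ} {ε p q τ : ℝ}
    (hδ : ∀ t ∈ Icc a b, 0 < δ t)
    (hε : ∀ P : TaggedPartition a b, P.IsFine δ → ‖P.sum G - (F b - F a)‖ < ε)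
    (hap : a ≤ p) (hpq : p < q) (hqb : q ≤ b) (hτ : τ ∈ Icc p q)
    (hfine : Icc p q ⊆ Ioo (τ - δ τ) (τ + δ τ)) (hp : HasKurzweilIntegral G a p (F p - F a))
    (hq : HasKurzweilIntegral G q b (F b - F q)) : ‖G τ q - G τ p - (F q - F p)‖ ≤ ε := by
  have := fineFilter_neBot hap
  have := fineFilter_neBot hqb
  have hlim : Tendsto
      (fun r : TaggedPartition a p × TaggedPartition q b =>
        r.1.sum G + (G τ q - G τ p) + r.2.sum G - (F b - F a))
      (fineFilter a p ×ˢ fineFilter q b) (𝓝 (G τ q - G τ p - (F q - F p))) := by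
    rw [show G τ q - G τ p - (F q - F p)
      = F p - F a + (G τ q - G τ p) + (F b - F q) - (F b - F a) by abel]
    exact (((hp.tendsto.comp tendsto_fst).add_const _).add
      (hq.tendsto.comp tendsto_snd)).sub_const _
  refine le_of_tendsto hlim.norm ?_
  filter_upwards [(eventually_isFine fun t ht => hδ t
    (Icc_subset_Icc_right (hpq.le.trans hqb) ht)).prod_mk (eventually_isFine fun t ht => hδ t
    (Icc_subset_Icc_left (hap.trans hpq.le) ht))] with r hr
  simpa only [TaggedPartition.append_sum, TaggedPartition.snoc_sum]
    using (hε _ ((hr.1.snoc q τ hpq hτ hfine).append hr.2)).le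

theorem tendsto_saksHenstock {F : ℝ → X} {τ : ℝ} (hτ : τ ∈ Icc a b)
    (hF : ∀ c d, c ≤ d → Icc c d ⊆ Icc a b → HasKurzweilIntegral G c d (F d - F c)) :
    Tendsto (fun p : ℝ × ℝ => G τ p.2 - G τ p.1 - (F p.2 - F p.1))
      (𝓝[Icc a τ] τ ×ˢ 𝓝[Icc τ b] τ) (𝓝 0) := by
  have hab := hτ.1.trans hτ.2
  refine (Metric.nhds_basis_closedBall.tendsto_right_iff).2 fun ε hε => ?_
  obtain ⟨δ, hδ, H⟩ := hF a b hab Subset.rfl ε hε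
  have hδτ := hδ τ hτ
  have hleft : ∀ᶠ p in 𝓝[Icc a τ] τ, p ∈ Icc a τ ∧ τ - δ τ < p :=
    eventually_mem_nhdsWithin.and (nhdsWithin_le_nhds (lt_mem_nhds (by linarith)))
  have hright : ∀ᶠ q in 𝓝[Icc τ b] τ, q ∈ Icc τ b ∧ q < τ + δ τ :=
    eventually_mem_nhdsWithin.and (nhdsWithin_le_nhds (gt_mem_nhds (by linarith)))
  filter_upwards [hleft.prod_mk hright] with ⟨p, q⟩ ⟨⟨hp, hpδ⟩, hq, hqδ⟩
  rw [mem_closedBall_zero_iff]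
  dsimp only at hp hpδ hq hqδ ⊢
  rcases (hp.2.trans hq.1).eq_or_lt with rfl | hpq
  · simpa only [sub_self, norm_zero] using hε.le
  exact norm_sub_le_of_forall_isFine hδ H hp.1 hpq hq.2 ⟨hp.2, hq.1⟩
    (Icc_subset_Ioo hpδ hqδ) (hF a p hp.1 (Icc_subset_Icc_right (hpq.le.trans hq.2)))
    (hF q b hq.2 (Icc_subset_Icc_left (hp.1.trans hpq.le)))

theorem tendsto_saksHenstock_nhdsWithin {F : ℝ → X} {τ : ℝ} (hτ : τ ∈ Icc a b)
    (hF : ∀ c d, c ≤ d → Icc c d ⊆ Icc a b → HasKurzweilIntegral G c d (F d - F c)) :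
    Tendsto (fun t => G τ t - G τ τ - (F t - F τ)) (𝓝[Icc a b] τ) (𝓝 0) := by
  have hSH := tendsto_saksHenstock hτ hF
  rw [← Icc_union_Icc_eq_Icc hτ.1 hτ.2, nhdsWithin_union]
  refine Tendsto.sup ?_ ?_
  · have hpair : Tendsto (fun p => (p, τ)) (𝓝[Icc a τ] τ) (𝓝[Icc a τ] τ ×ˢ 𝓝[Icc τ b] τ) :=
      tendsto_id.prodMk (tendsto_const_pure.mono_right
        (pure_le_nhdsWithin (left_mem_Icc.2 hτ.2)))
    refine (neg_zero (G := X) ▸ (hSH.comp hpair).neg).congr fun p => ?_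
    simp only [Function.comp_apply]
    abel
  · have hpair : Tendsto (fun q => (τ, q)) (𝓝[Icc τ b] τ) (𝓝[Icc a τ] τ ×ˢ 𝓝[Icc τ b] τ) :=
      (tendsto_const_pure.mono_right (pure_le_nhdsWithin (right_mem_Icc.2 hτ.1))).prodMk
        tendsto_id
    exact hSH.comp hpair

end KurzweilIntegral

section Control

variable {X : Type*} [NormedAddCommGroup X] {v w : ℝ → ℝ} {f : ℝ → X} {s : Set ℝ} {a b h l τ : ℝ}

/-- `v` is a monotone left-continuous function on `ℝ` whose increments dominate those of `f`
on `s`; it replaces the variation of `f` in all estimates. -/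
structure IsControl (v : ℝ → ℝ) (f : ℝ → X) (s : Set ℝ) : Prop where
  mono : Monotone v
  leftCont : ∀ t, ContinuousWithinAt v (Iio t) t
  norm_sub_le : ∀ c ∈ s, ∀ d ∈ s, c ≤ d → ‖f d - f c‖ ≤ v d - v c

theorem IsControl.subset {s' : Set ℝ} (h : IsControl v f s) (hs : s' ⊆ s) : IsControl v f s' :=
  ⟨h.mono, h.leftCont, fun c hc d hd => h.norm_sub_le c (hs hc) d (hs hd)⟩

theorem IsControl.congr {g : ℝ → X} (h : IsControl v f s) (hfg : EqOn f g s) :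
    IsControl v g s :=
  ⟨h.mono, h.leftCont, fun c hc d hd => hfg hc ▸ hfg hd ▸ h.norm_sub_le c hc d hd⟩

theorem IsControl.norm_le (h : IsControl v f s) {t : ℝ} (ha : a ∈ s) (ht : t ∈ s) (hat : a ≤ t) :
    ‖f t‖ ≤ ‖f a‖ + (v t - v a) :=
  (norm_le_norm_add_norm_sub' (f t) (f a)).trans (add_le_add_right (h.norm_sub_le a ha t ht hat) _)

theorem IsControl.const_mul {Y : Type*} [NormedAddCommGroup Y] {g : ℝ → Y} {C : ℝ}
    (h : IsControl v f s) (hC : 0 ≤ C)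
    (hg : ∀ c ∈ s, ∀ d ∈ s, c ≤ d → ‖g d - g c‖ ≤ C * (v d - v c)) :
    IsControl (fun t => C * v t) g s :=
  ⟨h.mono.const_mul hC, fun t => (h.leftCont t).const_mul C,
    fun c hc d hd hcd => (hg c hc d hd hcd).trans_eq (mul_sub _ _ _)⟩

theorem IsControl.continuousWithinAt (h : IsControl v f (Ici a)) {t : ℝ} (ht : a < t) :
    ContinuousWithinAt f (Iio t) t := by
  refine tendsto_iff_norm_sub_tendsto_zero.2 (squeeze_zero' (Eventually.of_forall fun _ =>
    norm_nonneg _) ?_ (by simpa only [sub_self] using (h.leftCont t).const_sub (v t)))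
  filter_upwards [Ioo_mem_nhdsLT ht] with r hr
  rw [norm_sub_rev]
  exact h.norm_sub_le r hr.1.le t ht.le hr.2.le

theorem IsControl.locallyBoundedVariationOn (h : IsControl v f s) :
    LocallyBoundedVariationOn f s := by
  intro p q hp hq
  have hv := (h.mono.monotoneOn s).locallyBoundedVariationOn p q hp hq
  refine ne_top_of_le_ne_top hv (iSup_le fun P => (Finset.sum_le_sum fun i _ => ?_).trans
    (le_iSup (fun P : ℕ × { u : ℕ → ℝ // Monotone u ∧ ∀ i, u i ∈ s ∩ Icc p q } =>
      ∑ i ∈ Finset.range P.1, edist (v (P.2.1 (i + 1))) (v (P.2.1 i))) P))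
  obtain ⟨-, u, hu, hus⟩ := P
  rw [edist_dist, edist_dist, dist_eq_norm, dist_eq_norm]
  exact ENNReal.ofReal_le_ofReal ((h.norm_sub_le _ (hus i).1 _ (hus (i + 1)).1
    (hu i.le_succ)).trans (Real.le_norm_self _))

theorem norm_sub_le_variationOnFromTo (hf : LocallyBoundedVariationOn f s) {c d : ℝ} (ha : a ∈ s)
    (hc : c ∈ s) (hd : d ∈ s) (hcd : c ≤ d) :
    ‖f d - f c‖ ≤ variationOnFromTo f s a d - variationOnFromTo f s a c := by
  rw [variationOnFromTo.sub_right hf ha hd hc, variationOnFromTo.eq_of_le f _ hcd,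
    ← dist_eq_norm]
  exact (hf c d hc hd).dist_le ⟨hd, hcd, le_rfl⟩ ⟨hc, le_rfl, hcd⟩

theorem exists_isControl (hf : LocallyBoundedVariationOn f (Ici a))
    (hleft : ∀ t > a, ContinuousWithinAt f (Iio t) t) : ∃ v, IsControl v f (Ici a) := by
  have ha : a ∈ Ici a := self_mem_Ici
  refine ⟨fun t => variationOnFromTo f (Ici a) a (max a t), fun c d hcd =>
    variationOnFromTo.monotoneOn hf ha (le_max_left a c) (le_max_left a d)
      (max_le_max le_rfl hcd), fun t => ?_, fun c hc d hd hcd => ?_⟩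
  · rcases le_or_gt t a with hta | hat
    · refine continuousWithinAt_const.congr (fun r hr => ?_) rfl
      rw [max_eq_left hta, max_eq_left ((mem_Iio.1 hr).le.trans hta)]
    · have hnhds : 𝓝[Ici a ∩ Iio t] t = 𝓝[<] t :=
        nhdsWithin_inter_of_mem (nhdsWithin_le_nhds (Ici_mem_nhds hat))
      have hlim := variationOnFromTo.tendsto_left ha hat.le hf
        (hleft t hat |>.mono_left hnhds.le)
      rw [hnhds, dist_self, sub_zero] at hlim
      refine (ContinuousWithinAt.congr_of_eventuallyEq hlim ?_ (by rw [max_eq_right hat.le]))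
      filter_upwards [Ioo_mem_nhdsLT hat] with r hr
      rw [max_eq_right hr.1.le]
  · simpa only [max_eq_right (mem_Ici.1 hc), max_eq_right (mem_Ici.1 hd)]
      using norm_sub_le_variationOnFromTo hf ha hc hd hcd

theorem eventually_sub_lt_of_leftCont (hl : ContinuousWithinAt w (Iio τ) τ) {ε : ℝ} (hε : 0 < ε) :
    ∀ᶠ p in 𝓝[Icc a τ] τ, w τ - w p < ε :=
  (((continuousWithinAt_Iio_iff_Iic.1 hl).mono Icc_subset_Iic_self).eventually
    (lt_mem_nhds (sub_lt_self (w τ) hε))).mono fun _ hp => sub_lt_comm.1 hp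

theorem IsControl.tendsto_rightLim [CompleteSpace X] (h : IsControl v f (Icc a b)) {t : ℝ}
    (ht : t ∈ Ico a b) : Tendsto f (𝓝[>] t) (𝓝 (Function.rightLim f t)) := by
  have hab := ht.1.trans ht.2.le
  have hvar : BoundedVariationOn f (Icc a b) := by
    simpa only [inter_self] using h.locallyBoundedVariationOn a b
      (left_mem_Icc.2 hab) (right_mem_Icc.2 hab)
  obtain ⟨L, hL⟩ := hvar.exists_tendsto_right t
  rw [nhdsWithin_inter_of_mem (mem_of_superset (Ioo_mem_nhdsGT ht.2)
    (Ioo_subset_Icc_self.trans (Icc_subset_Icc_left ht.1)))] at hL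
  rwa [rightLim_eq_of_tendsto hL]

theorem exists_superlevel_eq_Ioi (hw : Monotone w)
    (hl : ∀ t, ContinuousWithinAt w (Iio t) t) (ha : w a ≤ l) (hb : l < w b) :
    ∃ r, ∀ t, l < w t ↔ r < t := by
  obtain ⟨r, hr⟩ := Real.exists_isLUB (s := {t | w t ≤ l}) ⟨a, ha⟩
    ⟨b, fun t ht => (hw.reflect_lt ((mem_ofPred.1 ht).trans_lt hb)).le⟩
  have hrl : w r ≤ l := by
    by_contra! hlt
    obtain ⟨t, ht, ht'⟩ := ((hr.frequently_mem ⟨a, ha⟩).and_eventually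
      ((continuousWithinAt_Iio_iff_Iic.1 (hl r)).eventually (lt_mem_nhds hlt))).exists
    exact (mem_ofPred.1 ht).not_gt ht'
  exact ⟨r, fun t => lt_iff_lt_of_le_iff_le ⟨fun h => hr.1 h, fun h => (hw h).trans hrl⟩⟩

theorem hasKurzweilIntegral_indicator_Ioi {r : ℝ} (hr : r ∈ Ico a b) {L : X}
    (hL : Tendsto f (𝓝[>] r) (𝓝 L)) :
    HasKurzweilIntegral (fun τ t => if r < τ then f t else 0) a b (f b - L) := by
  suffices h : HasKurzweilIntegral (fun τ t => if r < τ then f t else 0) a b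
      ((if r < b then f b - L else 0) - if r < a then f a - L else 0) by
    simpa only [hr.2, hr.1.not_gt, if_true, if_false, sub_zero] using h
  refine hasKurzweilIntegral_of_locallyApprox (F := fun t => if r < t then f t - L else 0)
    fun ε hε => ⟨fun t => if r < t then ε / 2 else 0, ?_, fun τ _ => ?_⟩
  · simpa only [hr.2, hr.1.not_gt, if_true, if_false, sub_zero] using half_lt_self hε
  rcases lt_trichotomy τ r with hτr | rfl | hτr
  · have hright : ∀ᶠ q in 𝓝[Icc τ b] τ, q < r := nhdsWithin_le_nhds (gt_mem_nhds hτr)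
    filter_upwards [(eventually_mem_nhdsWithin (s := Icc a τ) (a := τ)).prod_mk hright]
      with p hp
    simp [hτr.not_gt, (hp.1.2.trans_lt hτr).not_gt, hp.2.not_gt]
  · have hright : ∀ᶠ q in 𝓝[Icc τ b] τ, τ < q → ‖f q - L‖ ≤ ε / 2 :=
      nhdsWithin_le_nhds (eventually_nhdsWithin_iff.1 ((tendsto_iff_norm_sub_tendsto_zero.1
        hL).eventually (ge_mem_nhds (half_pos hε))))
    filter_upwards [(eventually_mem_nhdsWithin (s := Icc a τ) (a := τ)).prod_mk hright]
      with p hp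
    rcases lt_or_ge τ p.2 with hq | hq
    · simpa [hp.1.2.not_gt, hq, norm_sub_rev] using hp.2 hq
    · simp [hp.1.2.not_gt, hq.not_gt]
  · have hleft : ∀ᶠ p in 𝓝[Icc a τ] τ, r < p := nhdsWithin_le_nhds (lt_mem_nhds hτr)
    filter_upwards [hleft.prod_mk (eventually_mem_nhdsWithin (s := Icc τ b) (a := τ))]
      with p hp
    simp [hτr, hp.1, hτr.trans_le hp.2.1]

theorem IsControl.kurzweilIntegrable_superlevel [CompleteSpace X] (h : IsControl v f (Icc a b))
    (hw : Monotone w) (hl : ∀ t, ContinuousWithinAt w (Iio t) t) (l : ℝ) :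
    KurzweilIntegrable (fun τ t => if l < w τ then f t else 0) a b := by
  rcases le_or_gt (w b) l with hb | hb
  · exact ⟨_, (hasKurzweilIntegral_const (fun _ => (0 : X)) a b).congr fun τ hτ _ _ =>
      (if_neg ((hw hτ.2).trans hb).not_gt).symm⟩
  rcases lt_or_ge l (w a) with ha | ha
  · exact ⟨_, (hasKurzweilIntegral_const f a b).congr fun τ hτ _ _ =>
      (if_pos (ha.trans_le (hw hτ.1))).symm⟩
  obtain ⟨r, hr⟩ := exists_superlevel_eq_Ioi hw hl ha hb
  have har : a ≤ r := not_lt.1 fun hra => ha.not_gt ((hr a).2 hra)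
  have hrb : r < b := (hr b).1 hb
  simp only [hr]
  exact ⟨_, hasKurzweilIntegral_indicator_Ioi ⟨har, hrb⟩ (h.tendsto_rightLim ⟨har, hrb⟩)⟩

/-- The number of levels `w a + j * h`, `j : ℕ`, that lie below `w τ`. Its level sets partition
`[a, ∞)` into intervals on which `w` oscillates by at most `h`. -/
noncomputable def levelIndex (w : ℝ → ℝ) (a h τ : ℝ) : ℕ :=
  ⌈(w τ - w a) / h⌉₊

theorem lt_levelIndex (hh : 0 < h) {τ : ℝ} {j : ℕ} :
    j < levelIndex w a h τ ↔ w a + j * h < w τ := by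
  rw [levelIndex, Nat.lt_ceil, lt_div_iff₀ hh, lt_sub_iff_add_lt']

theorem sub_le_of_levelIndex_eq (hw : Monotone w) (hh : 0 < h) {r τ : ℝ} (har : a ≤ r)
    (heq : levelIndex w a h r = levelIndex w a h τ) : w τ - w r ≤ h := by
  have hle : w τ ≤ w a + levelIndex w a h τ * h :=
    not_lt.1 fun hlt => (lt_irrefl _) ((lt_levelIndex hh).2 hlt)
  rcases Nat.eq_zero_or_eq_succ_pred (levelIndex w a h τ) with hzero | hsucc
  · rw [hzero, Nat.cast_zero, zero_mul, add_zero] at hle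
    linarith [hw har]
  · have hlt := (lt_levelIndex (w := w) (a := a) hh (τ := r)).1
      (show (levelIndex w a h τ).pred < _ by omega)
    rw [hsucc, Nat.cast_succ] at hle
    linarith

theorem IsControl.exists_norm_sub_comp_levelIndex_le (hf : IsControl w f (Ici a)) (hh : 0 < h) :
    ∃ e : ℕ → X, ∀ τ ≥ a, ‖f τ - e (levelIndex w a h τ)‖ ≤ h := by
  have hrep : ∀ n : ℕ, ∃ e : X, ∀ τ ≥ a, levelIndex w a h τ = n → ‖f τ - e‖ ≤ h := by
    intro n
    by_cases hn : ∃ r ≥ a, levelIndex w a h r = n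
    · obtain ⟨r, hr, rfl⟩ := hn
      refine ⟨f r, fun τ hτ heq => ?_⟩
      rcases le_total r τ with hle | hle
      · exact (hf.norm_sub_le r hr τ hτ hle).trans
          (sub_le_of_levelIndex_eq hf.mono hh hr heq.symm)
      · rw [norm_sub_rev]
        exact (hf.norm_sub_le τ hτ r hr hle).trans (sub_le_of_levelIndex_eq hf.mono hh hτ heq)
    · exact ⟨0, fun τ hτ heq => absurd ⟨τ, hτ, heq⟩ hn⟩
  choose e he using hrep
  exact ⟨e, fun τ hτ => he _ τ hτ rfl⟩

end Control

section Integrability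

variable {F X : Type*} [NormedAddCommGroup F] [NormedSpace ℝ F] [NormedAddCommGroup X]
  [NormedSpace ℝ X] {v w : ℝ → ℝ} {B : ℝ → F →L[ℝ] X} {y : ℝ → F} {s : Set ℝ} {a b h : ℝ}

theorem IsControl.norm_apply_sub_le (hB : IsControl v B s) {p q M : ℝ} (hp : p ∈ s) (hq : q ∈ s)
    (hpq : p ≤ q) {e : F} (he : ‖e‖ ≤ M) : ‖B q e - B p e‖ ≤ (v q - v p) * M := by
  rw [← sub_apply]
  exact ((B q - B p).le_of_opNorm_le (hB.norm_sub_le p hp q hq hpq) e).trans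
    (mul_le_mul_of_nonneg_left he (sub_nonneg.2 (hB.mono hpq)))

theorem IsControl.apply (hB : IsControl v B s) (e : F) :
    IsControl (fun t => ‖e‖ * v t) (fun t => B t e) s :=
  hB.const_mul (norm_nonneg e) fun _ hc _ hd hcd =>
    (hB.norm_apply_sub_le hc hd hcd le_rfl).trans_eq (mul_comm _ _)

theorem IsControl.kurzweilIntegrable_comp_levelIndex [CompleteSpace X]
    (hB : IsControl v B (Icc a b)) (hw : Monotone w) (hl : ∀ t, ContinuousWithinAt w (Iio t) t)
    (hh : 0 < h) (e : ℕ → F) :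
    KurzweilIntegrable (fun τ t => B t (e (levelIndex w a h τ))) a b := by
  have hlevel : ∀ j : ℕ, KurzweilIntegrable
      (fun τ t => if j < levelIndex w a h τ then B t (e (j + 1) - e j) else 0) a b := fun j => by
    simpa only [lt_levelIndex hh]
      using (hB.apply (e (j + 1) - e j)).kurzweilIntegrable_superlevel hw hl (w a + j * h)
  choose I hI using hlevel
  refine ⟨_, ((hasKurzweilIntegral_const (fun t => B t (e 0)) a b).add
    (HasKurzweilIntegral.finset_sum (Finset.range (levelIndex w a h b))
      fun j _ => hI j)).congr fun τ hτ t _ => ?_⟩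
  have hle : levelIndex w a h τ ≤ levelIndex w a h b :=
    Nat.ceil_mono (div_le_div_of_nonneg_right (sub_le_sub_right (hw hτ.2) _) hh.le)
  have hfilter : {j ∈ Finset.range (levelIndex w a h b) | j < levelIndex w a h τ}
      = Finset.range (levelIndex w a h τ) := by
    ext j
    simp only [Finset.mem_filter, Finset.mem_range]
    omega
  simp only [map_sub]
  rw [← Finset.sum_filter, hfilter, Finset.sum_range_sub (fun j => B t (e j)), add_sub_cancel]

theorem IsControl.norm_sum_sub_sum_le (hB : IsControl v B (Icc a b)) {z : ℝ → F}
    (hyz : ∀ τ ∈ Icc a b, ‖y τ - z τ‖ ≤ h) (P : TaggedPartition a b) :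
    ‖P.sum (fun τ t => B t (y τ)) - P.sum (fun τ t => B t (z τ))‖ ≤ (v b - v a) * h := by
  have hsum := P.norm_sum_sub_le (G := fun τ t => B t (y τ) - B t (z τ)) (F := fun _ => 0)
    (μ := fun t => v t * h) fun j hj => ?_
  · simpa only [P.sum_sub, sub_zero, ← sub_mul] using hsum
  · simp only [← map_sub, sub_self, sub_zero, ← sub_mul]
    exact hB.norm_apply_sub_le (P.pt_mem_Icc hj.le) (P.pt_mem_Icc hj) (P.pt_lt j hj).le
      (hyz _ (P.tag_mem_Icc hj))

theorem IsControl.kurzweilIntegrable [CompleteSpace X] (hB : IsControl v B (Icc a b))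
    (hy : IsControl w y (Ici a)) (hab : a ≤ b) :
    KurzweilIntegrable (fun τ t => B t (y τ)) a b := by
  refine kurzweilIntegrable_of_approx hab fun ε hε => ?_
  have hvab : 0 ≤ v b - v a := sub_nonneg.2 (hB.mono hab)
  have hh : 0 < ε / (v b - v a + 1) := by positivity
  obtain ⟨e, he⟩ := hy.exists_norm_sub_comp_levelIndex_le hh
  refine ⟨_, hB.kurzweilIntegrable_comp_levelIndex hy.mono hy.leftCont hh e, fun P =>
    (hB.norm_sum_sub_sum_le (fun τ hτ => he τ hτ.1) P).trans_lt ?_⟩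
  rw [mul_div_left_comm, mul_lt_iff_lt_one_right hε, div_lt_one (by positivity)]
  exact lt_add_one _

end Integrability

section IntegralBounds

variable {F X : Type*} [NormedAddCommGroup F] [NormedSpace ℝ F] [NormedAddCommGroup X]
  [NormedSpace ℝ X] {v w : ℝ → ℝ} {B : ℝ → F →L[ℝ] X} {y : ℝ → F} {c d s C M : ℝ} {J : X}

theorem IsControl.hasKurzweilIntegral_sub [CompleteSpace X] (hB : IsControl v B (Ici s))
    (hy : IsControl w y (Ici s)) (hsc : s ≤ c) (hcd : c ≤ d) :
    HasKurzweilIntegral (fun τ t => B t (y τ)) c d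
      (kurzweilIntegral (fun τ t => B t (y τ)) s d
        - kurzweilIntegral (fun τ t => B t (y τ)) s c) :=
  ((hB.subset Icc_subset_Ici_self).kurzweilIntegrable hy
    (hsc.trans hcd)).hasKurzweilIntegral_sub_of_base_le hsc hcd

theorem IsControl.norm_integral_le (hB : IsControl v B (Icc c d)) (hcd : c ≤ d)
    (hy : ∀ r ∈ Icc c d, ‖y r‖ ≤ M)
    (hJ : HasKurzweilIntegral (fun τ t => B t (y τ)) c d J) : ‖J‖ ≤ (v d - v c) * M := by
  refine hJ.norm_le_of_locallyApprox hcd fun η hη => ⟨fun t => v t * M, ?_, fun τ hτ => ?_⟩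
  · rw [← sub_mul]
    exact le_add_of_nonneg_right hη.le
  filter_upwards [(eventually_mem_nhdsWithin (s := Icc c τ) (a := τ)).prod_mk
    (eventually_mem_nhdsWithin (s := Icc τ d) (a := τ))] with p hp
  rw [sub_self, sub_zero, ← sub_mul]
  exact hB.norm_apply_sub_le (Icc_subset_Icc_right hτ.2 hp.1) (Icc_subset_Icc_left hτ.1 hp.2)
    (hp.1.2.trans hp.2.1) (hy τ hτ)

theorem IsControl.tendsto_integral (hB : IsControl v B (Icc c d)) (hcd : c ≤ d)
    {z : ℕ → ℝ → F} {ε : ℕ → ℝ} {I : ℕ → X} (hε : Tendsto ε atTop (𝓝 0))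
    (hz : ∀ n, ∀ r ∈ Icc c d, ‖z n r - y r‖ ≤ ε n)
    (hI : ∀ n, HasKurzweilIntegral (fun τ t => B t (z n τ)) c d (I n))
    (hJ : HasKurzweilIntegral (fun τ t => B t (y τ)) c d J) : Tendsto I atTop (𝓝 J) := by
  have hlim : Tendsto (fun n => (v d - v c) * ε n) atTop (𝓝 0) := by
    simpa only [mul_zero] using hε.const_mul (v d - v c)
  refine tendsto_iff_norm_sub_tendsto_zero.2 (squeeze_zero (fun _ => norm_nonneg _)
    (fun n => hB.norm_integral_le hcd (hz n) ?_) hlim)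
  exact ((hI n).sub hJ).congr fun _ _ _ _ => (map_sub _ _ _).symm

theorem IsControl.norm_integral_le_of_left_zero (hB : IsControl v B (Icc c d)) (hcd : c < d)
    (hy : ∀ r ∈ Icc c d, ‖y r‖ ≤ M) (hc : y c = 0)
    (hJ : HasKurzweilIntegral (fun τ t => B t (y τ)) c d J) :
    ‖J‖ ≤ (v d - Function.rightLim v c) * M := by
  have hM : 0 ≤ M := (norm_nonneg _).trans (hy c (left_mem_Icc.2 hcd.le))
  refine hJ.norm_le_of_locallyApprox hcd.le fun η hη =>
    ⟨fun t => if c < t then (v t - Function.rightLim v c) * M else 0, ?_, fun τ hτ => ?_⟩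
  · simpa only [if_pos hcd, lt_irrefl, if_false, sub_zero] using le_add_of_nonneg_right hη.le
  have hq : ∀ᶠ q in 𝓝[Icc τ d] τ, q ∈ Icc τ d := eventually_mem_nhdsWithin
  rcases hτ.1.eq_or_lt with rfl | hcτ
  · filter_upwards [(eventually_mem_nhdsWithin (s := Icc c c) (a := c)).prod_mk hq] with p hp
    have hpc : p.1 = c := le_antisymm hp.1.2 hp.1.1
    simp only [hc, map_zero, sub_self, norm_zero, hpc, lt_irrefl, if_false, sub_zero]
    split_ifs with hcp
    · exact mul_nonneg (sub_nonneg.2 (hB.mono.rightLim_le hcp)) hM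
    · exact le_rfl
  · have hp : ∀ᶠ p in 𝓝[Icc c τ] τ, p ∈ Icc c τ ∧ c < p :=
      eventually_mem_nhdsWithin.and (nhdsWithin_le_nhds (lt_mem_nhds hcτ))
    filter_upwards [hp.prod_mk hq] with p hp
    have hpq := hp.1.1.2.trans hp.2.1
    rw [if_pos hp.1.2, if_pos (hp.1.2.trans_le hpq), sub_self, sub_zero, ← sub_mul,
      sub_sub_sub_cancel_right]
    exact hB.norm_apply_sub_le (Icc_subset_Icc_right hτ.2 hp.1.1)
      (Icc_subset_Icc_left hτ.1 hp.2) hpq (hy τ hτ)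

/-- The weight `exp (2 (v t - v s))`: against it, integration with respect to a function
controlled by `v` halves bounds, as in Bielecki's proof of the Picard–Lindelöf theorem. -/
noncomputable def expWeight (v : ℝ → ℝ) (s t : ℝ) : ℝ :=
  Real.exp (2 * (v t - v s))

theorem expWeight_self (v : ℝ → ℝ) (s : ℝ) : expWeight v s s = 1 := by
  rw [expWeight, sub_self, mul_zero, Real.exp_zero]

theorem expWeight_pos (v : ℝ → ℝ) (s t : ℝ) : 0 < expWeight v s t :=
  Real.exp_pos _

theorem expWeight_mono (hv : Monotone v) (s : ℝ) : Monotone (expWeight v s) := fun _ _ hpq =>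
  Real.exp_le_exp.2 (mul_le_mul_of_nonneg_left (sub_le_sub_right (hv hpq) _) zero_le_two)

theorem expWeight_leftCont {t : ℝ} (hv : ContinuousWithinAt v (Iio t) t) (s : ℝ) :
    ContinuousWithinAt (expWeight v s) (Iio t) t :=
  ((hv.sub continuousWithinAt_const).const_mul 2).rexp

theorem sub_mul_expWeight_le (v : ℝ → ℝ) (s p q : ℝ) :
    (v q - v p) * expWeight v s p ≤ (expWeight v s q - expWeight v s p) / 2 := by
  have hfactor : expWeight v s q = Real.exp (2 * (v q - v p)) * expWeight v s p := by
    rw [expWeight, expWeight, ← Real.exp_add]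
    ring_nf
  rw [hfactor]
  nlinarith [Real.add_one_le_exp (2 * (v q - v p)), expWeight_pos v s p]

theorem IsControl.norm_integral_le_expWeight (hB : IsControl v B (Icc c d)) (hcd : c ≤ d)
    (hC : 0 ≤ C) (hy : ∀ r ∈ Icc c d, ‖y r‖ ≤ C * expWeight v s r)
    (hJ : HasKurzweilIntegral (fun τ t => B t (y τ)) c d J) :
    ‖J‖ ≤ C / 2 * (expWeight v s d - expWeight v s c) := by
  refine hJ.norm_le_of_locallyApprox hcd fun η hη => ?_
  have hv : 0 ≤ v d - v c := sub_nonneg.2 (hB.mono hcd)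
  obtain ⟨κ, hκ, hκη⟩ : ∃ κ > 0, κ * (v d - v c) ≤ η := by
    refine ⟨η / (v d - v c + 1), by positivity, ?_⟩
    rw [div_mul_comm]
    exact mul_le_of_le_one_left hη.le ((div_le_one (by positivity)).2 (by linarith))
  refine ⟨fun t => C / 2 * expWeight v s t + κ * v t, by linarith, fun τ hτ => ?_⟩
  have hp : ∀ᶠ p in 𝓝[Icc c τ] τ, p ∈ Icc c τ ∧
      C * expWeight v s τ - C * expWeight v s p < κ :=
    eventually_mem_nhdsWithin.and (eventually_sub_lt_of_leftCont
      ((expWeight_leftCont (hB.leftCont τ) s).const_mul C) hκ)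
  filter_upwards [hp.prod_mk (eventually_mem_nhdsWithin (s := Icc τ d) (a := τ))]
    with ⟨p, q⟩ ⟨⟨hp, hpκ⟩, hq⟩
  dsimp only at hp hpκ hq ⊢
  rw [sub_self, sub_zero]
  calc ‖B q (y τ) - B p (y τ)‖ ≤ (v q - v p) * (C * expWeight v s p + κ) :=
        hB.norm_apply_sub_le (Icc_subset_Icc_right hτ.2 hp) (Icc_subset_Icc_left hτ.1 hq)
          (hp.2.trans hq.1) (by linarith [hy τ hτ])
    _ = C * ((v q - v p) * expWeight v s p) + κ * (v q - v p) := by ring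
    _ ≤ C * ((expWeight v s q - expWeight v s p) / 2) + κ * (v q - v p) := by
        gcongr
        exact sub_mul_expWeight_le v s p q
    _ = C / 2 * expWeight v s q + κ * v q - (C / 2 * expWeight v s p + κ * v p) := by ring

end IntegralBounds

section LinearEquation

variable {F : Type*} [NormedAddCommGroup F] [NormedSpace ℝ F] {B : ℝ → F →L[ℝ] F} {v : ℝ → ℝ}
  {x y : ℝ → F} {S S' : Set ℝ} {c d s : ℝ}

theorem IsSolutionOn.mono (hx : IsSolutionOn B S x) (h : S' ⊆ S) : IsSolutionOn B S' x :=
  fun c d hcd hS => hx c d hcd (hS.trans h)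

theorem IsSolutionOn.sub (hx : IsSolutionOn B S x) (hy : IsSolutionOn B S y) :
    IsSolutionOn B S (fun t => x t - y t) := fun c d hcd hS => by
  simpa only [map_sub, sub_sub_sub_comm] using (hx c d hcd hS).sub (hy c d hcd hS)

theorem IsSolutionOn.exists_norm_le (hB : IsControl v B (Icc c d))
    (hx : IsSolutionOn B (Icc c d) x) : ∃ M, ∀ r ∈ Icc c d, ‖x r‖ ≤ M := by
  refine isCompact_Icc.induction_on (p := fun S => ∃ M, ∀ r ∈ S, ‖x r‖ ≤ M) ⟨0, by simp⟩
    (fun S T hST ⟨M, hM⟩ => ⟨M, fun r hr => hM r (hST hr)⟩)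
    (fun S T ⟨M, hM⟩ ⟨N, hN⟩ => ⟨max M N, fun r hr => hr.elim
      (fun hS => (hM r hS).trans (le_max_left M N))
      fun hT => (hN r hT).trans (le_max_right M N)⟩) fun τ hτ => ?_
  have hB_bound : ∀ r ∈ Icc c d, ‖B r (x τ) - B τ (x τ)‖ ≤ (v d - v c) * ‖x τ‖ := by
    intro r hr
    have hc := hB.mono hτ.1
    have hd := hB.mono hτ.2
    have hrc := hB.mono hr.1
    have hrd := hB.mono hr.2
    rcases le_total τ r with h | h
    · exact (hB.norm_apply_sub_le hτ hr h le_rfl).trans (by gcongr)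
    · rw [norm_sub_rev]
      exact (hB.norm_apply_sub_le hr hτ h le_rfl).trans (by gcongr)
  have hnear : ∀ᶠ r in 𝓝[Icc c d] τ, ‖B r (x τ) - B τ (x τ) - (x r - x τ)‖ < 1 :=
    (tendsto_saksHenstock_nhdsWithin hτ hx).norm.eventually (gt_mem_nhds (by simp))
  refine ⟨_, hnear.and eventually_mem_nhdsWithin, 1 + (v d - v c) * ‖x τ‖ + ‖x τ‖,
    fun r hr => ?_⟩
  calc ‖x r‖ = ‖B r (x τ) - B τ (x τ) - (B r (x τ) - B τ (x τ) - (x r - x τ)) + x τ‖ := by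
        congr 1
        abel
    _ ≤ ‖B r (x τ) - B τ (x τ)‖ + ‖B r (x τ) - B τ (x τ) - (x r - x τ)‖ + ‖x τ‖ :=
        (norm_add_le _ _).trans (add_le_add_left (norm_sub_le _ _) _)
    _ ≤ 1 + (v d - v c) * ‖x τ‖ + ‖x τ‖ := by linarith [hB_bound r hr.2, hr.1]

theorem IsSolutionOn.eq_zero (hB : IsControl v B (Icc c d)) (hx : IsSolutionOn B (Icc c d) x)
    (h₀ : x c = 0) : ∀ r ∈ Icc c d, x r = 0 := by
  intro r hr
  obtain ⟨M, hM⟩ := hx.exists_norm_le hB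
  have hM₀ : 0 ≤ M := (norm_nonneg _).trans (hM r hr)
  have hgeom : ∀ n : ℕ, ∀ t ∈ Icc c d, ‖x t‖ ≤ M * (1 / 2) ^ n * expWeight v c t := by
    intro n
    induction n with
    | zero =>
      intro t ht
      have hone := expWeight_self v c ▸ expWeight_mono hB.mono c ht.1
      rw [pow_zero, mul_one]
      exact (hM t ht).trans (le_mul_of_one_le_right hM₀ hone)
    | succ n ih =>
      intro t ht
      have hsub : Icc c t ⊆ Icc c d := Icc_subset_Icc_right ht.2
      have hJ := hx c t ht.1 hsub
      rw [h₀, sub_zero] at hJ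
      have hle := (hB.subset hsub).norm_integral_le_expWeight ht.1 (by positivity)
        (fun r hr => ih r (hsub hr)) hJ
      have hpos : 0 ≤ M * (1 / 2) ^ n / 2 * expWeight v c c := by
        have := expWeight_pos v c c
        positivity
      rw [pow_succ]
      linarith
  have hlim : Tendsto (fun n : ℕ => M * (1 / 2) ^ n * expWeight v c r) atTop (𝓝 0) := by
    simpa using ((tendsto_pow_atTop_nhds_zero_of_lt_one (r := (1 / 2 : ℝ)) (by norm_num)
      (by norm_num)).const_mul M).mul_const (expWeight v c r)
  exact norm_le_zero_iff.1 (ge_of_tendsto' hlim fun n => hgeom n r hr)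

theorem IsSolutionOn.eqOn (hB : IsControl v B (Icc c d)) (hx : IsSolutionOn B (Icc c d) x)
    (hy : IsSolutionOn B (Icc c d) y) (h₀ : x c = y c) : EqOn x y (Icc c d) := fun r hr =>
  sub_eq_zero.1 ((hx.sub hy).eq_zero hB (sub_eq_zero.2 h₀) r hr)

/-- The Picard iterates of `x t = x₀ + ∫_s^t d[B] x`, starting from the constant `x₀`. -/
noncomputable def picardIterate (B : ℝ → F →L[ℝ] F) (s : ℝ) (x₀ : F) : ℕ → ℝ → F
  | 0, _ => x₀
  | n + 1, t => x₀ + kurzweilIntegral (fun τ r => B r (picardIterate B s x₀ n τ)) s t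

theorem picardIterate_self (B : ℝ → F →L[ℝ] F) (s : ℝ) (x₀ : F) (n : ℕ) :
    picardIterate B s x₀ n s = x₀ := by
  cases n with
  | zero => rfl
  | succ n => rw [picardIterate, kurzweilIntegral_self, add_zero]

theorem IsControl.norm_picardIterate_le {x₀ : F} {n : ℕ} {r : ℝ}
    (hn : IsControl (fun t => ‖x₀‖ * expWeight v s t) (picardIterate B s x₀ n) (Ici s))
    (hr : s ≤ r) : ‖picardIterate B s x₀ n r‖ ≤ ‖x₀‖ * expWeight v s r := by
  have hle := hn.norm_le self_mem_Ici hr hr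
  rwa [picardIterate_self, expWeight_self, mul_one, add_sub_cancel] at hle

variable [CompleteSpace F]

theorem IsControl.hasKurzweilIntegral_picardIterate {w : ℝ → ℝ} {x₀ : F} {n : ℕ}
    (hB : IsControl v B (Ici s)) (hn : IsControl w (picardIterate B s x₀ n) (Ici s))
    (hsc : s ≤ c) (hcd : c ≤ d) :
    HasKurzweilIntegral (fun τ t => B t (picardIterate B s x₀ n τ)) c d
      (picardIterate B s x₀ (n + 1) d - picardIterate B s x₀ (n + 1) c) := by
  simpa only [picardIterate, add_sub_add_left_eq_sub] using hB.hasKurzweilIntegral_sub hn hsc hcd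

theorem isControl_picardIterate (hB : IsControl v B (Ici s)) (x₀ : F) (n : ℕ) :
    IsControl (fun t => ‖x₀‖ * expWeight v s t) (picardIterate B s x₀ n) (Ici s) := by
  have hmono := (expWeight_mono hB.mono s).const_mul (norm_nonneg x₀)
  have hleft : ∀ t, ContinuousWithinAt (fun t => ‖x₀‖ * expWeight v s t) (Iio t) t :=
    fun t => (expWeight_leftCont (hB.leftCont t) s).const_mul _
  induction n with
  | zero =>
    refine ⟨hmono, hleft, fun _ _ _ _ hcd => ?_⟩
    simpa only [picardIterate, sub_self, norm_zero, sub_nonneg] using hmono hcd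
  | succ n ih =>
    refine ⟨hmono, hleft, fun c hc d _ hcd => ?_⟩
    have hle := (hB.subset (Icc_subset_Ici_iff hcd |>.2 hc)).norm_integral_le_expWeight hcd
      (norm_nonneg x₀) (fun r hr => ih.norm_picardIterate_le (hc.trans hr.1))
      (hB.hasKurzweilIntegral_picardIterate ih hc hcd)
    linarith [hmono hcd]

theorem IsControl.norm_picardIterate_succ_sub_le (hB : IsControl v B (Ici s)) (x₀ : F) (n : ℕ)
    {r : ℝ} (hr : s ≤ r) :
    ‖picardIterate B s x₀ (n + 1) r - picardIterate B s x₀ n r‖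
      ≤ ‖x₀‖ * (1 / 2) ^ n * expWeight v s r := by
  induction n generalizing r with
  | zero =>
    have hle := (isControl_picardIterate hB x₀ (0 + 1)).norm_sub_le s self_mem_Ici r hr hr
    rw [picardIterate_self, expWeight_self, mul_one] at hle
    rw [pow_zero, mul_one]
    exact hle.trans (sub_le_self _ (norm_nonneg x₀))
  | succ n ih =>
    have hint (k : ℕ) :=
      hB.hasKurzweilIntegral_picardIterate (isControl_picardIterate hB x₀ k) le_rfl hr
    have hJ := (hint (n + 1)).sub (hint n)
    simp only [← map_sub, picardIterate_self, sub_sub_sub_cancel_right] at hJ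
    have hle := (hB.subset Icc_subset_Ici_self).norm_integral_le_expWeight hr (by positivity)
      (fun t ht => ih ht.1) hJ
    have hpos : 0 ≤ ‖x₀‖ * (1 / 2) ^ n / 2 := by positivity
    rw [expWeight_self] at hle
    rw [pow_succ]
    linarith

theorem IsControl.exists_picardLimit (hB : IsControl v B (Ici s)) (x₀ : F) :
    ∃ x : ℝ → F, ∀ r ≥ s, Tendsto (fun n => picardIterate B s x₀ n r) atTop (𝓝 (x r)) ∧
      ∀ n, ‖picardIterate B s x₀ n r - x r‖
        ≤ 2 * (‖x₀‖ * expWeight v s r) * (1 / 2) ^ n := by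
  have hdist : ∀ r ≥ s, ∀ n, dist (picardIterate B s x₀ n r)
      (picardIterate B s x₀ (n + 1) r) ≤ ‖x₀‖ * expWeight v s r * (1 / 2) ^ n := by
    intro r hr n
    rw [dist_comm, dist_eq_norm, mul_right_comm]
    exact hB.norm_picardIterate_succ_sub_le x₀ n hr
  have hlim : ∀ r ≥ s, ∃ l, Tendsto (fun n => picardIterate B s x₀ n r) atTop (𝓝 l) :=
    fun r hr => cauchySeq_tendsto_of_complete
      (cauchySeq_of_le_geometric _ _ (by norm_num) (hdist r hr))
  choose! x hx using hlim
  refine ⟨x, fun r hr => ⟨hx r hr, fun n => ?_⟩⟩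
  have hle := dist_le_of_le_geometric_of_tendsto _ _ (by norm_num) (hdist r hr) (hx r hr) n
  rw [dist_eq_norm] at hle
  exact hle.trans_eq (by ring)

theorem IsControl.exists_solution (hB : IsControl v B (Ici s)) (x₀ : F) :
    ∃ x : ℝ → F, x s = x₀ ∧ IsSolutionOn B (Ici s) x ∧
      IsControl (fun t => ‖x₀‖ * expWeight v s t) x (Ici s) := by
  obtain ⟨x, hx⟩ := hB.exists_picardLimit x₀
  have hxs : x s = x₀ := tendsto_nhds_unique (hx s le_rfl).1
    (by simp only [picardIterate_self, tendsto_const_nhds])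
  have hxw : IsControl (fun t => ‖x₀‖ * expWeight v s t) x (Ici s) := by
    have hn := isControl_picardIterate hB x₀
    exact ⟨(hn 0).mono, (hn 0).leftCont, fun c hc d hd hcd =>
      le_of_tendsto ((hx d hd).1.sub (hx c hc).1).norm
        (Eventually.of_forall fun n => (hn n).norm_sub_le c hc d hd hcd)⟩
  refine ⟨x, hxs, fun c d hcd hS => ?_, hxw⟩
  have hsc : s ≤ c := hS (left_mem_Icc.2 hcd)
  have hJ := hB.hasKurzweilIntegral_sub hxw hsc hcd
  have hgeom : Tendsto (fun n : ℕ => 2 * (‖x₀‖ * expWeight v s d) * (1 / 2) ^ n) atTop (𝓝 0) := by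
    simpa using (tendsto_pow_atTop_nhds_zero_of_lt_one (r := (1 / 2 : ℝ)) (by norm_num)
      (by norm_num)).const_mul (2 * (‖x₀‖ * expWeight v s d))
  have hclose (n : ℕ) (r : ℝ) (hr : r ∈ Icc c d) :
      ‖picardIterate B s x₀ n r - x r‖ ≤ 2 * (‖x₀‖ * expWeight v s d) * (1 / 2) ^ n := by
    have hweight := expWeight_mono hB.mono s hr.2
    exact ((hx r (hsc.trans hr.1)).2 n).trans (by gcongr)
  have hlimJ := (hB.subset hS).tendsto_integral hcd hgeom hclose (fun n =>
    hB.hasKurzweilIntegral_picardIterate (isControl_picardIterate hB x₀ n) hsc hcd) hJ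
  have hlim := ((hx d (hsc.trans hcd)).1.sub (hx c hsc).1).comp (tendsto_add_atTop_nat 1)
  rwa [tendsto_nhds_unique hlim hlimJ]

theorem IsSolutionOn.isControl (hB : IsControl v B (Ici s)) (hx : IsSolutionOn B (Ici s) x) :
    IsControl (fun t => ‖x s‖ * expWeight v s t) x (Ici s) := by
  obtain ⟨y, hys, hy, hyw⟩ := hB.exists_solution (x s)
  refine hyw.congr fun r hr => ?_
  exact IsSolutionOn.eqOn (hB.subset Icc_subset_Ici_self) (hy.mono Icc_subset_Ici_self)
    (hx.mono Icc_subset_Ici_self) hys (right_mem_Icc.2 hr)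

theorem IsSolutionOn.isAdmissible (hB : IsControl v B (Ici s))
    (hx : IsSolutionOn B (Ici s) x) : IsAdmissible s x :=
  ⟨(hx.isControl hB).locallyBoundedVariationOn, fun _ ht =>
    (hx.isControl hB).continuousWithinAt ht⟩

end LinearEquation

section TransitionMatrix

variable {E : Type*} [NormedAddCommGroup E] [NormedSpace ℝ E] {A : ℝ → E →L[ℝ] E}
  {U V : ℝ → ℝ → E →L[ℝ] E} {X : ℝ → E →L[ℝ] E} {x : ℝ → E} {v : ℝ → ℝ} {S : Set ℝ}
  {s t τ c : ℝ}

/-- Left multiplication by `A t`. The matrix equation `dX/dτ = D[A(t)X]` is the linear equation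
in `E →L[ℝ] E` with this coefficient. -/
noncomputable def leftMul (A : ℝ → E →L[ℝ] E) (t : ℝ) : (E →L[ℝ] E) →L[ℝ] (E →L[ℝ] E) :=
  ContinuousLinearMap.mul ℝ (E →L[ℝ] E) (A t)

theorem leftMul_apply (A : ℝ → E →L[ℝ] E) (t : ℝ) (C : E →L[ℝ] E) : leftMul A t C = A t * C :=
  rfl

theorem isControl_leftMul (hA : IsControl v A S) : IsControl v (leftMul A) S :=
  ⟨hA.mono, hA.leftCont, fun c hc d hd hcd => by
    rw [leftMul, leftMul, ← map_sub]
    exact (ContinuousLinearMap.opNorm_mul_apply_le ℝ _ _).trans (hA.norm_sub_le c hc d hd hcd)⟩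

theorem IsSolutionOn.mul_const (hX : IsSolutionOn (leftMul A) S X) (C : E →L[ℝ] E) :
    IsSolutionOn (leftMul A) S (fun t => X t * C) := fun c d hcd hS =>
  ((hX c d hcd hS).map ((ContinuousLinearMap.mul ℝ (E →L[ℝ] E)).flip C)).congr
    fun _ _ _ _ => mul_assoc _ _ _

theorem IsSolutionOn.apply_const (hX : IsSolutionOn (leftMul A) S X) (e : E) :
    IsSolutionOn A S (fun t => X t e) := fun c d hcd hS =>
  (hX c d hcd hS).map (ContinuousLinearMap.apply ℝ E e)

theorem IsSolutionOn.tendsto_right {F : Type*} [NormedAddCommGroup F] [NormedSpace ℝ F]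
    {B : ℝ → F →L[ℝ] F} {y : ℝ → F} {L : F} (hy : IsSolutionOn B (Ici τ) y)
    (hL : Tendsto (fun t => B t (y τ)) (𝓝[>] τ) (𝓝 L)) :
    Tendsto y (𝓝[>] τ) (𝓝 (y τ + (L - B τ (y τ)))) := by
  have hSH := tendsto_saksHenstock_nhdsWithin (left_mem_Icc.2 (lt_add_one τ).le)
    (hy.mono Icc_subset_Ici_self)
  have hIcc : 𝓝[>] τ ≤ 𝓝[Icc τ (τ + 1)] τ := by
    rw [← nhdsWithin_Ioo_eq_nhdsGT (lt_add_one τ)]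
    exact nhdsWithin_mono τ Ioo_subset_Icc_self
  have hlim := ((hL.sub_const (B τ (y τ))).sub (hSH.mono_left hIcc)).const_add (y τ)
  rw [sub_zero] at hlim
  exact hlim.congr fun t => by abel

theorem IsControl.eventually_expWeight_lt_two (hA : IsControl v A S) (a τ : ℝ) :
    ∀ᶠ c in 𝓝[Icc a τ] τ, expWeight v c τ < 2 := by
  filter_upwards [eventually_sub_lt_of_leftCont (hA.leftCont τ)
    (half_pos (Real.log_pos one_lt_two))] with c hc
  exact (Real.lt_log_iff_exp_lt two_pos).1 (by linarith)

variable [CompleteSpace E]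

theorem IsSolutionOn.isUnit_of_expWeight_lt_two (hA : IsControl v A (Ici c))
    (hX : IsSolutionOn (leftMul A) (Ici c) X) (hc : IsUnit (X c)) (hct : c ≤ t)
    (ht : expWeight v c t < 2) : IsUnit (X t) := by
  obtain ⟨u, hu⟩ := hc
  let Z : ℝ → E →L[ℝ] E := fun r => X r * ↑u⁻¹
  have hZc : Z c = 1 := by
    change X c * ↑u⁻¹ = 1
    rw [← hu, u.mul_inv]
  have hZt : ‖1 - Z t‖ < 1 := by
    have hle := ((hX.mul_const ↑u⁻¹).isControl (isControl_leftMul hA)).norm_sub_le c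
      self_mem_Ici t hct hct
    have hone : ‖(1 : E →L[ℝ] E)‖ ≤ 1 := ContinuousLinearMap.norm_id_le
    have hweight : 1 ≤ expWeight v c t := expWeight_self v c ▸ expWeight_mono hA.mono c hct
    change ‖Z t - Z c‖ ≤ ‖Z c‖ * _ - ‖Z c‖ * _ at hle
    rw [hZc, expWeight_self, norm_sub_rev] at hle
    nlinarith
  have hunit := (isUnit_one_sub_of_norm_lt_one hZt).mul u.isUnit
  rwa [sub_sub_cancel, Units.inv_mul_cancel_right] at hunit

theorem IsSolutionOn.eventually_isUnit (hA : IsControl v A (Ici τ))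
    (hD : IsUnit (1 + (Function.rightLim A τ - A τ))) (hX : IsSolutionOn (leftMul A) (Ici τ) X)
    (hτ : IsUnit (X τ)) : ∀ᶠ t in 𝓝[≥] τ, IsUnit (X t) := by
  have hAlim : Tendsto A (𝓝[>] τ) (𝓝 (Function.rightLim A τ)) :=
    (hA.subset Icc_subset_Ici_self).tendsto_rightLim ⟨le_rfl, lt_add_one τ⟩
  have hXlim := hX.tendsto_right (hAlim.mul_const (X τ))
  rw [leftMul_apply, ← sub_mul, ← one_add_mul] at hXlim
  rw [← Ioi_insert, nhdsWithin_insert, eventually_sup, eventually_pure]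
  exact ⟨hτ, hXlim.eventually (Units.isOpen.mem_nhds (hD.mul hτ))⟩

theorem IsSolutionOn.isUnit (hA : IsControl v A (Ici s))
    (hD : ∀ t ≥ s, IsUnit (1 + (Function.rightLim A t - A t)))
    (hX : IsSolutionOn (leftMul A) (Ici s) X) (hs : IsUnit (X s)) (hst : s ≤ t) :
    IsUnit (X t) := by
  refine interval_induction hst (R := fun p q => IsUnit (X p) → IsUnit (X q))
    (fun _ _ _ _ _ _ _ hcm hmd => hmd ∘ hcm) (fun τ _ => ?_) (fun τ hτ => ?_) hs
  · filter_upwards [hA.eventually_expWeight_lt_two s τ, eventually_mem_nhdsWithin] with p hp hpτ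
    have hsub : Ici p ⊆ Ici s := Ici_subset_Ici.2 hpτ.1
    exact fun hXp => (hX.mono hsub).isUnit_of_expWeight_lt_two (hA.subset hsub) hXp hpτ.2 hp
  · by_cases hXτ : IsUnit (X τ)
    · have hsub : Ici τ ⊆ Ici s := Ici_subset_Ici.2 hτ.1
      exact (((hX.mono hsub).eventually_isUnit (hA.subset hsub) (hD τ hτ.1) hXτ).filter_mono
        (nhdsWithin_mono τ Icc_subset_Ici_self)).mono fun _ ht _ => ht
    · exact Eventually.of_forall fun _ h => absurd h hXτ

theorem isTransitionMatrix_iff : IsTransitionMatrix A U ↔ ∀ s ≥ 0, U s s = 1 ∧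
    IsSolutionOn (leftMul A) (Icc 0 s) (fun t => U t s) ∧
      IsSolutionOn (leftMul A) (Ici s) (fun t => U t s) := by
  refine ⟨fun h s hs => ⟨?_, fun c d hcd hsub => ?_, fun c d hcd hsub => ?_⟩,
    fun h t ht s hs => ?_⟩
  · rw [(h s hs s hs).2, kurzweilIntegral_self, add_zero]
  · have hc : 0 ≤ c := (hsub (left_mem_Icc.2 hcd)).1
    have hd : d ≤ s := (hsub (right_mem_Icc.2 hcd)).2
    have hint := (h c hc s hs).1
    rw [min_eq_right (hcd.trans hd), max_eq_left (hcd.trans hd)] at hint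
    dsimp only
    rw [(h c hc s hs).2, (h d (hc.trans hcd) s hs).2, add_sub_add_left_eq_sub]
    exact hint.hasKurzweilIntegral_sub_of_le_base hcd hd
  · have hc : s ≤ c := hsub (left_mem_Icc.2 hcd)
    have hint := (h d (hs.le.trans (hc.trans hcd)) s hs).1
    rw [min_eq_left (hc.trans hcd), max_eq_right (hc.trans hcd)] at hint
    dsimp only
    rw [(h c (hs.le.trans hc) s hs).2, (h d (hs.le.trans (hc.trans hcd)) s hs).2,
      add_sub_add_left_eq_sub]
    exact hint.hasKurzweilIntegral_sub_of_base_le hc hcd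
  · obtain ⟨hdiag, hback, hforw⟩ := h s hs
    rcases le_total s t with hst | hts
    · have hJ := hforw s t hst Icc_subset_Ici_self
      simp only [leftMul_apply] at hJ
      rw [min_eq_left hst, max_eq_right hst, hJ.integral_eq hst, hdiag]
      exact ⟨⟨_, hJ⟩, (add_sub_cancel _ _).symm⟩
    · have hJ := hback t s hts (Icc_subset_Icc_left ht)
      simp only [leftMul_apply] at hJ
      rw [min_eq_right hts, max_eq_left hts, kurzweilIntegral_symm _ t s, hJ.integral_eq hts,
        hdiag]
      exact ⟨⟨_, hJ⟩, by abel⟩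

theorem IsTransitionMatrix.isSolutionOn_Ici (hU : IsTransitionMatrix A U) (hs : 0 ≤ s) :
    IsSolutionOn (leftMul A) (Ici s) (fun t => U t s) :=
  (isTransitionMatrix_iff.1 hU s hs).2.2

theorem IsTransitionMatrix.diag (hU : IsTransitionMatrix A U) (hs : 0 ≤ s) : U s s = 1 :=
  (isTransitionMatrix_iff.1 hU s hs).1

theorem IsTransitionMatrix.eq_mul (hU : IsTransitionMatrix A U) (hA : IsControl v A (Ici 0))
    (hs : 0 ≤ s) (hst : s ≤ t) (hX : IsSolutionOn (leftMul A) (Icc s t) X) :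
    X t = U t s * X s := by
  refine hX.eqOn (isControl_leftMul (hA.subset (Icc_subset_Ici_iff hst |>.2 hs)))
    (((hU.isSolutionOn_Ici hs).mono Icc_subset_Ici_self).mul_const (X s)) ?_
    (right_mem_Icc.2 hst)
  rw [hU.diag hs, one_mul]

theorem IsTransitionMatrix.eq_apply (hU : IsTransitionMatrix A U) (hA : IsControl v A (Ici 0))
    (hs : 0 ≤ s) (hst : s ≤ t) (hx : IsSolutionOn A (Icc s t) x) : x t = U t s (x s) := by
  refine hx.eqOn (hA.subset (Icc_subset_Ici_iff hst |>.2 hs))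
    (((hU.isSolutionOn_Ici hs).mono Icc_subset_Ici_self).apply_const (x s)) ?_
    (right_mem_Icc.2 hst)
  rw [hU.diag hs, one_apply_eq_self]

theorem IsTransitionMatrix.mul (hU : IsTransitionMatrix A U) (hA : IsControl v A (Ici 0))
    {r : ℝ} (hs : 0 ≤ s) (hsr : s ≤ r) (hrt : r ≤ t) : U t r * U r s = U t s :=
  (hU.eq_mul hA (hs.trans hsr) hrt ((hU.isSolutionOn_Ici hs).mono
    (Icc_subset_Ici_iff hrt |>.2 hsr))).symm

theorem IsTransitionMatrix.unique (hU : IsTransitionMatrix A U) (hV : IsTransitionMatrix A V)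
    (hA : IsControl v A (Ici 0)) (hD : ∀ t ≥ 0, IsUnit (1 + (Function.rightLim A t - A t)))
    (ht : 0 ≤ t) (hs : 0 ≤ s) : V t s = U t s := by
  rcases le_total s t with hst | hts
  · have hVU := hU.eq_mul hA hs hst ((hV.isSolutionOn_Ici hs).mono Icc_subset_Ici_self)
    rwa [hV.diag hs, mul_one] at hVU
  · have hdiag : IsUnit (U t t) := by
      rw [hU.diag ht]
      exact isUnit_one
    have hunit : IsUnit (U s t) := IsSolutionOn.isUnit (X := (U · t))
      (hA.subset (Ici_subset_Ici.2 ht)) (fun r hr => hD r (ht.trans hr))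
      (hU.isSolutionOn_Ici ht) hdiag hts
    have hback {W : ℝ → ℝ → E →L[ℝ] E} (hW : IsTransitionMatrix A W) : U s t * W t s = 1 := by
      rw [← hU.eq_mul hA ht hts (((isTransitionMatrix_iff.1 hW s hs).2.1).mono
        (Icc_subset_Icc_left ht)), hW.diag hs]
    exact hunit.mul_left_cancel ((hback hV).trans (hback hU).symm)

theorem exists_isTransitionMatrix (hA : IsControl v A (Ici 0))
    (hD : ∀ t ≥ 0, IsUnit (1 + (Function.rightLim A t - A t))) :
    ∃ U, IsTransitionMatrix A U := by
  obtain ⟨X, hX₀, hX, -⟩ := (isControl_leftMul hA).exists_solution 1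
  refine ⟨fun t s => X t * Ring.inverse (X s), isTransitionMatrix_iff.2 fun s hs =>
    ⟨Ring.mul_inverse_cancel _ (hX.isUnit hA hD (hX₀ ▸ isUnit_one) hs), ?_, ?_⟩⟩
  · exact (hX.mul_const _).mono Icc_subset_Ici_self
  · exact (hX.mul_const _).mono (Ici_subset_Ici.2 hs)

end TransitionMatrix

section VariationOfConstants

variable {E : Type*} [NormedAddCommGroup E] [NormedSpace ℝ E] {A : ℝ → E →L[ℝ] E}
  {U : ℝ → ℝ → E →L[ℝ] E} {x y z : ℝ → E} {v w ν : ℝ → ℝ} {s t c d K V γ : ℝ}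

/-- The function `y(t) - ∫_s^t d[A(ξ)] y(ξ)`, which is constant exactly for solutions `y`. -/
noncomputable def defect (A : ℝ → E →L[ℝ] E) (s : ℝ) (y : ℝ → E) (t : ℝ) : E :=
  y t - kurzweilIntegral (fun τ r => A r (y τ)) s t

theorem IsSolutionOn.defectVariation_eq_zero (hx : IsSolutionOn A (Ici s) x) :
    defectVariation A s x = 0 := by
  refine le_antisymm (iSup₂_le fun t _ => le_of_eq (eVariationOn.constant_on ?_)) zero_le
  refine (subsingleton_singleton (a := x s)).anti (image_subset_iff.2 fun r hr => ?_)
  exact (congrArg (x r - ·) ((hx s r hr.1 Icc_subset_Ici_self).integral_eq hr.1)).trans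
    (sub_sub_cancel _ _)

theorem le_two_mul_of_self_bound {α : Type*} {S : Set α} {f : α → ℝ} (hf : BddAbove (f '' S))
    (h : ∀ M, (∀ r ∈ S, f r ≤ M) → ∀ r ∈ S, f r ≤ V + M / 2) : ∀ r ∈ S, f r ≤ 2 * V := by
  have hle : ∀ r ∈ S, f r ≤ sSup (f '' S) := fun r hr => le_csSup hf (mem_image_of_mem f hr)
  intro r hr
  have hsup : sSup (f '' S) ≤ V + sSup (f '' S) / 2 :=
    csSup_le ⟨f r, mem_image_of_mem f hr⟩ (forall_mem_image.2 (h _ hle))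
  linarith [hle r hr]

theorem IsControl.norm_le_two_mul (hA : IsControl v A (Icc c d)) (hcd : c ≤ d)
    (hv : v d - Function.rightLim v c ≤ 1 / 2) (hzc : z c = 0)
    (hbdd : BddAbove ((fun r => ‖z r‖) '' Icc c d))
    (hz : ∀ r ∈ Icc c d, ∃ J, HasKurzweilIntegral (fun τ t => A t (z τ)) c r J ∧
      ‖z r - J‖ ≤ V) : ‖z d‖ ≤ 2 * V := by
  refine le_two_mul_of_self_bound hbdd (fun M hM r hr => ?_) d (right_mem_Icc.2 hcd)
  obtain ⟨J, hJ, hzJ⟩ := hz r hr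
  have hM₀ : 0 ≤ M := (norm_nonneg _).trans (hM r hr)
  rcases hr.1.eq_or_lt with rfl | hcr
  · rw [hzc, norm_zero]
    linarith [(norm_nonneg _).trans hzJ]
  · have hsub : Icc c r ⊆ Icc c d := Icc_subset_Icc_right hr.2
    have hJM := (hA.subset hsub).norm_integral_le_of_left_zero hcr (fun q hq => hM q (hsub hq))
      hzc hJ
    have hvr : v r - Function.rightLim v c ≤ 1 / 2 := by linarith [hA.mono hr.2]
    have hhalf := mul_le_mul_of_nonneg_right hvr hM₀
    linarith [norm_le_norm_sub_add (z r) J]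

variable [CompleteSpace E]

theorem IsTransitionMatrix.norm_sub_le_of_small (hU : IsTransitionMatrix A U)
    (hA : IsControl v A (Ici 0)) (hy : IsControl w y (Ici s)) (hs : 0 ≤ s) (hsc : s ≤ c)
    (hcd : c ≤ d) (hv : v d - Function.rightLim v c ≤ 1 / 2)
    (hν : ∀ p ∈ Icc c d, ∀ q ∈ Icc c d, p ≤ q →
      ‖defect A s y q - defect A s y p‖ ≤ ν q - ν p) :
    ‖y d - U d c (y c)‖ ≤ 2 * (ν d - ν c) := by
  have hc : 0 ≤ c := hs.trans hsc
  have hAcd : IsControl v A (Icc c d) := hA.subset (Icc_subset_Ici_iff hcd |>.2 hc)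
  have hsol := (hU.isSolutionOn_Ici hc).apply_const (y c)
  have hUc : U c c (y c) = y c := by rw [hU.diag hc, one_apply_eq_self]
  refine hAcd.norm_le_two_mul (z := fun r => y r - U r c (y c)) hcd hv (sub_eq_zero.2 hUc.symm)
    ?_ fun r hr => ?_
  · obtain ⟨N, hN⟩ := (hsol.mono Icc_subset_Ici_self).exists_norm_le hAcd
    refine ⟨‖y c‖ + (w d - w c) + N, forall_mem_image.2 fun r hr => ?_⟩
    have hyr := hy.norm_le hsc (hsc.trans hr.1) hr.1
    linarith [norm_sub_le (y r) (U r c (y c)), hN r hr, hy.mono hr.2]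
  · have hJ := ((hA.subset (Ici_subset_Ici.2 hs)).hasKurzweilIntegral_sub hy hsc hr.1).sub
      (hsol c r hr.1 Icc_subset_Ici_self)
    refine ⟨_, hJ.congr fun τ _ t _ => (map_sub (A t) _ _).symm, ?_⟩
    have hrd := (norm_nonneg _).trans (hν r hr d (right_mem_Icc.2 hcd) hr.2)
    have hcr := hν c (left_mem_Icc.2 hcd) r hr hr.1
    dsimp only
    rw [hUc]
    calc _ = ‖defect A s y r - defect A s y c‖ := by
          rw [defect, defect]
          congr 1
          abel
      _ ≤ ν d - ν c := by linarith

theorem IsTransitionMatrix.norm_sub_le (hU : IsTransitionMatrix A U) (hA : IsControl v A (Ici 0))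
    (hy : IsControl w y (Ici s)) (hs : 0 ≤ s) (hst : s ≤ t)
    (hν : ∀ p ∈ Icc s t, ∀ q ∈ Icc s t, p ≤ q →
      ‖defect A s y q - defect A s y p‖ ≤ ν q - ν p)
    (hK : ∀ r ∈ Icc s t, ‖U t r‖ ≤ K) : ‖y t - U t s (y s)‖ ≤ K * (2 * (ν t - ν s)) := by
  have hsmall {c d : ℝ} (hsc : s ≤ c) (hcd : c ≤ d) (hdt : d ≤ t)
      (hv : v d - Function.rightLim v c ≤ 1 / 2) :
      ‖U t d (y d) - U t c (y c)‖ ≤ K * (2 * (ν d - ν c)) := by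
    have hsub : Icc c d ⊆ Icc s t := Icc_subset_Icc hsc hdt
    rw [← hU.mul hA (hs.trans hsc) hcd hdt, mul_apply_eq_comp, ← map_sub]
    exact (U t d).le_of_opNorm_le_of_le (hK d (hsub (right_mem_Icc.2 hcd)))
      (hU.norm_sub_le_of_small hA hy hs hsc hcd hv
        fun p hp q hq => hν p (hsub hp) q (hsub hq))
  have hchain := interval_induction hst
    (R := fun p q => ‖U t q (y q) - U t p (y p)‖ ≤ K * (2 * (ν q - ν p)))
    (fun c m d _ _ _ _ hcm hmd => ?_) (fun τ hτ => ?_) (fun τ hτ => ?_)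
  · rwa [hU.diag (hs.trans hst), one_apply_eq_self] at hchain
  · linarith [norm_sub_le_norm_sub_add_norm_sub (U t d (y d)) (U t m (y m)) (U t c (y c))]
  · filter_upwards [eventually_sub_lt_of_leftCont (hA.leftCont τ) one_half_pos,
      eventually_mem_nhdsWithin] with c hc hcτ
    exact hsmall hcτ.1 hcτ.2 hτ.2 (by linarith [hA.mono.le_rightLim (le_refl c)])
  · have hright : ∀ᶠ d in 𝓝[>] τ, v d < Function.rightLim v τ + 1 / 2 :=
      (hA.mono.tendsto_rightLim τ).eventually (gt_mem_nhds (by linarith))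
    rw [← Ioc_insert_left hτ.2, nhdsWithin_insert, eventually_sup, eventually_pure]
    refine ⟨by simp, ?_⟩
    filter_upwards [nhdsWithin_mono τ Ioc_subset_Ioi_self hright, eventually_mem_nhdsWithin]
      with d hd hdτ
    exact hsmall hτ.1 hdτ.1.le hdτ.2 (by linarith)

theorem IsTransitionMatrix.norm_sub_le_of_defectVariation_le (hU : IsTransitionMatrix A U)
    (hA : IsControl v A (Ici 0)) (hy : IsAdmissible s y) (hs : 0 ≤ s) (hst : s ≤ t) (hγ : 0 ≤ γ)
    (hV : defectVariation A s y ≤ ENNReal.ofReal γ) (hK : ∀ r ∈ Icc s t, ‖U t r‖ ≤ K) :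
    ‖y t - U t s (y s)‖ ≤ K * (2 * γ) := by
  obtain ⟨w, hw⟩ := exists_isControl hy.1 hy.2
  have hs_mem : s ∈ Icc s t := left_mem_Icc.2 hst
  have hle : eVariationOn (defect A s y) (Icc s t) ≤ ENNReal.ofReal γ :=
    (le_iSup₂ (f := fun t (_ : t ≥ s) => eVariationOn (defect A s y) (Icc s t)) t hst).trans hV
  have hbv : BoundedVariationOn (defect A s y) (Icc s t) :=
    ne_top_of_le_ne_top ENNReal.ofReal_ne_top hle
  have hsub := hU.norm_sub_le hA hw hs hst (fun p hp q hq =>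
    norm_sub_le_variationOnFromTo hbv.locallyBoundedVariationOn hs_mem hp hq) hK
  rw [variationOnFromTo.self, sub_zero, variationOnFromTo.eq_of_le _ _ hst, inter_self] at hsub
  have hK₀ : 0 ≤ K := (norm_nonneg _).trans (hK s hs_mem)
  exact hsub.trans (by gcongr; exact ENNReal.toReal_le_of_le_ofReal hγ hle)

end VariationOfConstants

section Stability

variable {E : Type*} [NormedAddCommGroup E] [NormedSpace ℝ E] {A : ℝ → E →L[ℝ] E}
  {U : ℝ → ℝ → E →L[ℝ] E} {v : ℝ → ℝ} {s t C T : ℝ}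

theorem opNorm_le_div_of_closedBall {F : Type*} [NormedAddCommGroup F] [NormedSpace ℝ F]
    {f : E →L[ℝ] F} {r : ℝ} (hr : 0 < r) (hf : ∀ e, ‖e‖ ≤ r → ‖f e‖ ≤ C) : ‖f‖ ≤ C / r := by
  have hC : 0 ≤ C := (norm_nonneg _).trans (hf 0 (norm_zero.trans_le hr.le))
  refine ContinuousLinearMap.opNorm_le_of_unit_norm (by positivity) fun e he => ?_
  have hre := hf (r • e) (by rw [norm_smul, he, mul_one, Real.norm_of_nonneg hr.le])
  rwa [map_smul, norm_smul, Real.norm_of_nonneg hr.le, ← le_div_iff₀' hr] at hre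

theorem half_pow_floor_le (x : ℝ) :
    (1 / 2 : ℝ) ^ ⌊x⌋₊ ≤ 2 * Real.exp (-Real.log 2 * x) := by
  have hexp : Real.exp (-Real.log 2) = 1 / 2 := by
    rw [Real.exp_neg, Real.exp_log two_pos, one_div]
  calc (1 / 2 : ℝ) ^ ⌊x⌋₊ = 2 * Real.exp (-Real.log 2 * (⌊x⌋₊ + 1)) := by
        rw [mul_add_one, Real.exp_add, mul_comm _ (⌊x⌋₊ : ℝ), Real.exp_nat_mul, hexp]
        ring
    _ ≤ 2 * Real.exp (-Real.log 2 * x) := by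
        have hlt := (Nat.lt_floor_add_one x).le
        have hlog := Real.log_pos one_lt_two
        gcongr 2 * Real.exp ?_
        nlinarith

theorem exists_forall_mul_exp_lt (K : ℝ) {α ε : ℝ} (hα : 0 < α) (hε : 0 < ε) :
    ∃ T ≥ 0, ∀ t ≥ T, K * Real.exp (-α * t) < ε := by
  have hlim : Tendsto (fun t : ℝ => K * Real.exp (-α * t)) atTop (𝓝 0) := by
    simpa only [mul_zero, Function.comp_def, id] using (Real.tendsto_exp_atBot.comp
      (tendsto_id.const_mul_atTop_of_neg (neg_lt_zero.2 hα))).const_mul K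
  obtain ⟨T, hT⟩ := eventually_atTop.1 (hlim.eventually (gt_mem_nhds hε))
  exact ⟨max T 0, le_max_right T 0, fun t ht => hT t ((le_max_left T 0).trans ht)⟩

theorem HasUniformExponentialDecay.exists_norm_le (h : HasUniformExponentialDecay U) :
    ∃ K > 0, ∀ s ≥ 0, ∀ t ≥ s, ‖U t s‖ ≤ K := by
  obtain ⟨K, hK, α, hα, hdecay⟩ := h
  refine ⟨K, hK, fun s hs t hst => (hdecay s hs t hst).trans (mul_le_of_le_one_right hK.le
    (Real.exp_le_one_iff.2 (mul_nonpos_of_nonpos_of_nonneg (neg_nonpos.2 hα.le)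
      (sub_nonneg.2 hst))))⟩

theorem HasUniformExponentialDecay.exists_forall_norm_lt (h : HasUniformExponentialDecay U)
    {ε : ℝ} (hε : 0 < ε) : ∃ T ≥ 0, ∀ s ≥ 0, ∀ t ≥ s + T, ‖U t s‖ < ε := by
  obtain ⟨K, -, α, hα, hdecay⟩ := h
  obtain ⟨T, hT₀, hT⟩ := exists_forall_mul_exp_lt K hα hε
  exact ⟨T, hT₀, fun s hs t ht => (hdecay s hs t (by linarith)).trans_lt (hT _ (by linarith))⟩

theorem GloballyUniformlyExponentiallyStable.uniformlyAsymptoticallyStable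
    (h : GloballyUniformlyExponentiallyStable A) : UniformlyAsymptoticallyStable A := by
  obtain ⟨K, hK, α, hα, hdecay⟩ := h
  refine ⟨fun ε hε => ⟨ε / K, by positivity, fun s hs x hx hxs t hst => ?_⟩, 1, one_pos,
    fun ε hε => ?_⟩
  · have hexp : Real.exp (-α * (t - s)) ≤ 1 := Real.exp_le_one_iff.2
      (mul_nonpos_of_nonpos_of_nonneg (neg_nonpos.2 hα.le) (sub_nonneg.2 hst))
    calc ‖x t‖ ≤ K * ‖x s‖ * Real.exp (-α * (t - s)) := hdecay s hs x hx t hst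
      _ ≤ K * ‖x s‖ := mul_le_of_le_one_right (by positivity) hexp
      _ < ε := (lt_div_iff₀' hK).1 hxs
  · obtain ⟨T, hT₀, hT⟩ := exists_forall_mul_exp_lt K hα hε
    refine ⟨T, hT₀, fun s hs x hx hxs t ht => ?_⟩
    calc ‖x t‖ ≤ K * ‖x s‖ * Real.exp (-α * (t - s)) := hdecay s hs x hx t (by linarith)
      _ ≤ K * Real.exp (-α * (t - s)) := by
        gcongr
        exact mul_le_of_le_one_right hK.le hxs.le
      _ < ε := hT _ (by linarith)

variable [CompleteSpace E]

theorem VariationallyAsymptoticallyStable.uniformlyAsymptoticallyStable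
    (h : VariationallyAsymptoticallyStable A) (hA : IsControl v A (Ici 0)) :
    UniformlyAsymptoticallyStable A := by
  obtain ⟨hstable, δ₀, hδ₀, hattr⟩ := h
  have hadm {s : ℝ} (hs : 0 ≤ s) {x : ℝ → E} (hx : IsSolutionOn A (Ici s) x) :
      IsAdmissible s x := hx.isAdmissible (hA.subset (Ici_subset_Ici.2 hs))
  have hdefect {s : ℝ} {x : ℝ → E} (hx : IsSolutionOn A (Ici s) x) {γ : ℝ} (hγ : 0 < γ) :
      defectVariation A s x < ENNReal.ofReal γ :=
    hx.defectVariation_eq_zero ▸ ENNReal.ofReal_pos.2 hγ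
  refine ⟨fun ε hε => ?_, δ₀, hδ₀, fun ε hε => ?_⟩
  · obtain ⟨δ, hδ, H⟩ := hstable ε hε
    exact ⟨δ, hδ, fun s hs x hx hxs => H s hs x (hadm hs hx) hxs (hdefect hx hδ)⟩
  · obtain ⟨T, hT, γ, hγ, H⟩ := hattr ε hε
    exact ⟨T, hT, fun s hs x hx hxs => H s hs x (hadm hs hx) hxs (hdefect hx hγ)⟩

theorem IsTransitionMatrix.norm_le_half_pow (hU : IsTransitionMatrix A U)
    (hA : IsControl v A (Ici 0)) (hT : 0 ≤ T) (hbound : ∀ s ≥ 0, ∀ t ≥ s, ‖U t s‖ ≤ C)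
    (hhalf : ∀ s ≥ 0, ‖U (s + T) s‖ ≤ 1 / 2) (n : ℕ) (hs : 0 ≤ s) (ht : s + n * T ≤ t) :
    ‖U t s‖ ≤ C * (1 / 2) ^ n := by
  induction n generalizing s with
  | zero => simpa using hbound s hs t (by simpa using ht)
  | succ n ih =>
    have hnT : 0 ≤ n * T := by positivity
    push_cast at ht
    rw [← hU.mul hA hs (show s ≤ s + T by linarith) (show s + T ≤ t by linarith), pow_succ,
      ← mul_assoc]
    exact norm_mul_le_of_le (ih (add_nonneg hs hT) (by linarith)) (hhalf s hs)

theorem IsTransitionMatrix.hasUniformExponentialDecay (hU : IsTransitionMatrix A U)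
    (hA : IsControl v A (Ici 0)) (hC : 0 < C) (hT : 0 < T)
    (hbound : ∀ s ≥ 0, ∀ t ≥ s, ‖U t s‖ ≤ C) (hhalf : ∀ s ≥ 0, ‖U (s + T) s‖ ≤ 1 / 2) :
    HasUniformExponentialDecay U := by
  refine ⟨C * 2, mul_pos hC two_pos, Real.log 2 / T, div_pos (Real.log_pos one_lt_two) hT,
    fun s hs t hst => ?_⟩
  have hfloor : ⌊(t - s) / T⌋₊ * T ≤ t - s :=
    (le_div_iff₀ hT).1 (Nat.floor_le (div_nonneg (sub_nonneg.2 hst) hT.le))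
  calc ‖U t s‖ ≤ C * (1 / 2) ^ ⌊(t - s) / T⌋₊ :=
        hU.norm_le_half_pow hA hT.le hbound hhalf _ hs (by linarith)
    _ ≤ C * (2 * Real.exp (-Real.log 2 * ((t - s) / T))) := 
        mul_le_mul_of_nonneg_left (half_pow_floor_le _) hC.le
    _ = C * 2 * Real.exp (-(Real.log 2 / T) * (t - s)) := by
        rw [mul_assoc]
        ring_nf

theorem UniformlyAsymptoticallyStable.hasUniformExponentialDecay
    (h : UniformlyAsymptoticallyStable A) (hU : IsTransitionMatrix A U)
    (hA : IsControl v A (Ici 0)) : HasUniformExponentialDecay U := by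
  obtain ⟨hstable, δ₀, hδ₀, hattr⟩ := h
  obtain ⟨δ, hδ, hle_one⟩ := hstable 1 one_pos
  obtain ⟨T, hT, hsmall⟩ := hattr (δ₀ / 4) (by positivity)
  have hsol {s : ℝ} (hs : 0 ≤ s) (e : E) := (hU.isSolutionOn_Ici hs).apply_const e
  have hinit {s r : ℝ} (hs : 0 ≤ s) (hr : 0 < r) {e : E} (he : ‖e‖ ≤ r / 2) :
      ‖U s s e‖ < r := by
    rw [hU.diag hs, one_apply_eq_self]
    exact he.trans_lt (half_lt_self hr)
  refine hU.hasUniformExponentialDecay hA (C := 1 / (δ / 2)) (T := T + 1) (by positivity)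
    (by positivity) (fun s hs t hst => ?_) fun s hs => ?_
  · exact opNorm_le_div_of_closedBall (half_pos hδ) fun e he =>
      (hle_one s hs _ (hsol hs e) (hinit hs hδ he) t hst).le
  · calc ‖U (s + (T + 1)) s‖ ≤ δ₀ / 4 / (δ₀ / 2) :=
          opNorm_le_div_of_closedBall (half_pos hδ₀) fun e he =>
            (hsmall s hs _ (hsol hs e) (hinit hs hδ₀ he) (s + (T + 1)) (by linarith)).le
      _ = 1 / 2 := by field_simp; norm_num

theorem HasUniformExponentialDecay.variationallyAsymptoticallyStable
    (h : HasUniformExponentialDecay U) (hU : IsTransitionMatrix A U)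
    (hA : IsControl v A (Ici 0)) : VariationallyAsymptoticallyStable A := by
  obtain ⟨K, hK, hbound⟩ := h.exists_norm_le
  have hest {γ : ℝ} (hγ : 0 < γ) {s : ℝ} (hs : 0 ≤ s) {y : ℝ → E} (hy : IsAdmissible s y)
      (hV : defectVariation A s y < ENNReal.ofReal γ) {t : ℝ} (hst : s ≤ t) :
      ‖y t‖ ≤ K * (2 * γ) + ‖U t s‖ * ‖y s‖ :=
    (norm_le_norm_sub_add (y t) (U t s (y s))).trans (add_le_add
      (hU.norm_sub_le_of_defectVariation_le hA hy hs hst hγ.le hV.le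
        fun r hr => hbound r (hs.trans hr.1) t hr.2) ((U t s).le_opNorm (y s)))
  refine ⟨fun ε hε => ?_, 1, one_pos, fun ε hε => ?_⟩
  · refine ⟨ε / (4 * K), by positivity, fun s hs y hy hys hV t hst => ?_⟩
    calc ‖y t‖ ≤ K * (2 * (ε / (4 * K))) + ‖U t s‖ * ‖y s‖ := hest (by positivity) hs hy hV hst
      _ ≤ K * (2 * (ε / (4 * K))) + K * (ε / (4 * K)) := by
        gcongr
        exact hbound s hs t hst
      _ = 3 / 4 * ε := by field_simp; norm_num
      _ < ε := by linarith
  · obtain ⟨T, hT, hsmall⟩ := h.exists_forall_norm_lt (half_pos hε)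
    refine ⟨T, hT, ε / (4 * K), by positivity, fun s hs y hy hys hV t ht => ?_⟩
    calc ‖y t‖ ≤ K * (2 * (ε / (4 * K))) + ‖U t s‖ * ‖y s‖ :=
          hest (by positivity) hs hy hV (by linarith)
      _ ≤ K * (2 * (ε / (4 * K))) + ‖U t s‖ := by
        gcongr
        exact mul_le_of_le_one_right (norm_nonneg _) hys.le
      _ < K * (2 * (ε / (4 * K))) + ε / 2 := by
        gcongr
        exact hsmall s hs t ht
      _ = ε := by field_simp; norm_num

theorem HasUniformExponentialDecay.globallyUniformlyExponentiallyStable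
    (h : HasUniformExponentialDecay U) (hU : IsTransitionMatrix A U)
    (hA : IsControl v A (Ici 0)) : GloballyUniformlyExponentiallyStable A := by
  obtain ⟨K, hK, α, hα, hdecay⟩ := h
  refine ⟨K, hK, α, hα, fun s hs x hx t hst => ?_⟩
  rw [hU.eq_apply hA hs hst (hx.mono Icc_subset_Ici_self), mul_right_comm]
  exact (U t s).le_of_opNorm_le (hdecay s hs t hst) (x s)

end Stability

end GLDE

theorem theorem5p3_general {E : Type*} [NormedAddCommGroup E] [NormedSpace ℝ E] [CompleteSpace E]
    (A : ℝ → E →L[ℝ] E)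
    (hBV : LocallyBoundedVariationOn A (Ici 0))
    (hleft : ∀ t > 0, ContinuousWithinAt A (Iio t) t)
    (hD : ∀ t ≥ 0, IsUnit (1 + (Function.rightLim A t - A t))) :
    ∃ U : ℝ → ℝ → E →L[ℝ] E,
      GLDE.IsTransitionMatrix A U ∧
      (∀ V : ℝ → ℝ → E →L[ℝ] E, GLDE.IsTransitionMatrix A V →
        ∀ t ≥ 0, ∀ s ≥ 0, V t s = U t s) ∧
      (GLDE.VariationallyAsymptoticallyStable A ↔ GLDE.HasUniformExponentialDecay U) ∧
      (GLDE.VariationallyAsymptoticallyStable A ↔ GLDE.UniformlyAsymptoticallyStable A) ∧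
      (GLDE.VariationallyAsymptoticallyStable A ↔
        GLDE.GloballyUniformlyExponentiallyStable A) := by
  obtain ⟨v, hA⟩ := GLDE.exists_isControl hBV hleft
  obtain ⟨U, hU⟩ := GLDE.exists_isTransitionMatrix hA hD
  have uniform_of_variational (h : GLDE.VariationallyAsymptoticallyStable A) :
      GLDE.UniformlyAsymptoticallyStable A := h.uniformlyAsymptoticallyStable hA
  have decay_of_uniform (h : GLDE.UniformlyAsymptoticallyStable A) :
      GLDE.HasUniformExponentialDecay U := h.hasUniformExponentialDecay hU hA
  have variational_of_decay (h : GLDE.HasUniformExponentialDecay U) :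
      GLDE.VariationallyAsymptoticallyStable A := h.variationallyAsymptoticallyStable hU hA
  refine ⟨U, hU, fun V hV t ht s hs => hU.unique hV hA hD ht hs,
    ⟨fun h => decay_of_uniform (uniform_of_variational h), variational_of_decay⟩,
    ⟨uniform_of_variational, fun h => variational_of_decay (decay_of_uniform h)⟩,
    fun h => ?_, fun h => ?_⟩
  · exact (decay_of_uniform (uniform_of_variational h)).globallyUniformlyExponentiallyStable hU hA
  · exact variational_of_decay (decay_of_uniform h.uniformlyAsymptoticallyStable)

theorem theorem5p3 {E : Type*} [NormedAddCommGroup E] [NormedSpace ℝ E] [FiniteDimensional ℝ E]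
    (A : ℝ → E →L[ℝ] E)
    (hBV : LocallyBoundedVariationOn A (Ici 0))
    (hleft : ∀ t > 0, ContinuousWithinAt A (Iio t) t)
    (hD : GLDE.ConditionD A) :
    ∃ U : ℝ → ℝ → E →L[ℝ] E,
      GLDE.IsTransitionMatrix A U ∧
      (∀ V : ℝ → ℝ → E →L[ℝ] E, GLDE.IsTransitionMatrix A V →
        ∀ t ≥ 0, ∀ s ≥ 0, V t s = U t s) ∧
      (GLDE.VariationallyAsymptoticallyStable A ↔ GLDE.HasUniformExponentialDecay U) ∧
      (GLDE.VariationallyAsymptoticallyStable A ↔ GLDE.UniformlyAsymptoticallyStable A) ∧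
      (GLDE.VariationallyAsymptoticallyStable A ↔
        GLDE.GloballyUniformlyExponentiallyStable A) := by
  have := FiniteDimensional.complete ℝ E
  exact theorem5p3_general A hBV hleft hD.2
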